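/- All graphs are finite, undirected, without loops or parallel edges. A graph $G$ is *3-connected* if it has more than three vertices and $G - X$ is connected for every set $X$ of at most two vertices; it is *claw-free* if it has no induced subgraph isomorphic to $K_{1,3}$. A *$\Lambda$-factor* of a graph is a spanning subgraph each of whose components is a 3-vertex path. For a subgraph $L$ of $G$, $G - L$ denotes the graph obtained from $G$ by deleting all vertices of $L$. Let $G$ be a 3-connected claw-free graph whose number of vertices $v(G)$ satisfies $v(G) \equiv 0 \bmod 3$. Then: (1) For every edge $xy$ of $G$ (and either choice of which end is called $y$) there exist at least two distinct 3-vertex paths $L_1$ and $L_2$ in $G$, each having $y$ as its middle vertex and containing the edge $xy$, such that for each $i \in \{1,2\}$ the graph $G - L_i$ is connected and has a $\Lambda$-factor. (2) For every edge $e$ of $G$ there exists a $\Lambda$-factor of $G$ containing $e$. -/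

import Mathlib

namespace LambdaPacking

variable {V : Type*}

/-- `G` is `k`-connected: it has more than `k` vertices, and deleting any set of fewer than `k`
vertices leaves a connected graph. -/
def IsKConnected [Fintype V] (G : SimpleGraph V) (k : ℕ) : Prop :=
  k < Fintype.card V ∧
    ∀ X : Finset V, X.card < k → (G.induce {v | v ∉ X}).Connected

/-- `G` is claw-free: it has no induced subgraph isomorphic to the claw `K_{1,3}`. -/
def IsClawFree (G : SimpleGraph V) : Prop :=
  ¬ (completeBipartiteGraph (Fin 1) (Fin 3)).IsIndContained G

/-- The subgraph `L` of `G` is a 3-vertex path whose middle vertex is `y`. -/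
def IsThreePathCenteredAt {G : SimpleGraph V} (L : G.Subgraph) (y : V) : Prop :=
  ∃ φ : SimpleGraph.pathGraph 3 ≃g L.coe, (φ 1 : V) = y

/-- The subgraph `F` of `G` is a `Λ`-factor of `G`: it is spanning, and each of its components
is a 3-vertex path. -/
def IsLambdaFactor {G : SimpleGraph V} (F : G.Subgraph) : Prop :=
  F.IsSpanning ∧
    ∀ c : F.coe.ConnectedComponent, Nonempty (c.toSimpleGraph ≃g SimpleGraph.pathGraph 3)

/-- `G - L`, the subgraph of `G` induced by the vertices outside `L`. -/
abbrev minus (G : SimpleGraph V) (L : G.Subgraph) : SimpleGraph ↥(L.vertsᶜ) :=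
  G.induce L.vertsᶜ

end LambdaPacking

/-! Call a connected graph a chain if it has at most two end-blocks. Two facts about claw-free
graphs carry the proof. By `Chain.fac`, a chain whose order is divisible by three has a Λ-factor. By
`Conn3.exists_two_chain`, in a 3-connected graph with given x and y there are two neighbours z of y
such that deleting x, y, z leaves a chain. For an edge xy, deleting the path x y z therefore leaves
a connected graph with a Λ-factor, which is (1); adding the path back gives (2).

For the second fact let D be the graph without x and y. If D has no cut vertex, every neighbour z of
y in D works: three end-blocks of D - z would all see z and produce a claw. Otherwise each side of a
cut vertex of D contains an end-block interior P, and each such P contains a suitable z. Indeed a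
bad z in P leaves three end-blocks. Each sees two of x, y, z by 3-connectivity, and each of x, y, z
sees at most two of them by claw-freeness. So one sees x and z, one y and z, one x and y, and the
first two lie in P. Replacing z by a neighbour of y in the second one strictly shrinks that one, so
this descent ends at a good z.

The first fact is an induction on the order. The 3-connected case removes a path given by the second
fact. At a 2-vertex cut, and at a cut vertex, the sides are recombined according to their orders mod
3; claw-freeness makes the pieces chains. What remains are graphs in which every cut vertex splits
off a single leaf. There the path l c a is removed, where l is a leaf at c and a is a neighbour of c
that is no cut vertex. If this does not leave a chain, then there is a second leaf together with a
leg, a set attached at a and one further vertex f. A leg of maximal order, taken with none, one or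
both of its attachments to suit the residue, is a chain with a chain as complement.

Everything is phrased for vertex sets. Connectivity is tested on closed subsets, and end-blocks are
replaced by pendant sets (at most one exit vertex), so that no block decomposition is needed. -/

namespace LambdaPacking

set_option linter.unusedSectionVars false

/-! ### Connectivity, pendant sets and path partitions of vertex sets -/

section

variable {V : Type*} [DecidableEq V] {G : SimpleGraph V}

/-- Every claw centre has two adjacent leaves. -/
def ClawFree (G : SimpleGraph V) : Prop :=
  ∀ ⦃v a b c⦄, G.Adj v a → G.Adj v b → G.Adj v c → a ≠ b → a ≠ c → b ≠ c →
    G.Adj a b ∨ G.Adj a c ∨ G.Adj b c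

/-- The subgraph induced by `S` is (pre)connected. -/
def Conn (G : SimpleGraph V) (S : Finset V) : Prop :=
  ∀ ⦃T⦄, T ⊆ S → T.Nonempty → (∀ a ∈ T, ∀ b ∈ S, G.Adj a b → b ∈ T) → S ⊆ T

/-- `T` is a nonempty subset of `S` with at most one neighbour in `S \ T`. -/
def Pend (G : SimpleGraph V) (S T : Finset V) : Prop :=
  T ⊆ S ∧ T.Nonempty ∧ ∃ g, ∀ a ∈ T, ∀ b ∈ S, G.Adj a b → b ∈ T ∨ b = g

/-- `T` and `U` are disjoint and there is no edge between them. -/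
def Sep (G : SimpleGraph V) (T U : Finset V) : Prop :=
  ∀ a ∈ T, ∀ b ∈ U, a ≠ b ∧ ¬ G.Adj a b

/-- The subgraph induced by `S` is connected with at most two end-blocks. -/
def Chain (G : SimpleGraph V) (S : Finset V) : Prop :=
  Conn G S ∧ ∀ ⦃T₁ T₂ T₃⦄, Pend G S T₁ → Pend G S T₂ → Pend G S T₃ →
    Sep G T₁ T₂ → Sep G T₁ T₃ → Sep G T₂ T₃ → False

/-- `S` is partitioned into three-vertex paths. -/
inductive Fac (G : SimpleGraph V) : Finset V → Prop
  | nil : Fac G ∅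
  | cons {S : Finset V} {a b c : V} : Fac G S → a ∉ S → b ∉ S → c ∉ S → a ≠ c →
      G.Adj a b → G.Adj b c → Fac G (insert a (insert b (insert c S)))

/-- Pigeonhole, the usual way to establish `Chain`: a pendant set must be near one of two places,
and separate sets cannot be near the same place. -/
theorem false_of_three_of_two {P Q : Finset V → Prop} {T₁ T₂ T₃ : Finset V}
    (h₁ : P T₁ ∨ Q T₁) (h₂ : P T₂ ∨ Q T₂) (h₃ : P T₃ ∨ Q T₃)
    (hP : ∀ T U, Sep G T U → P T → ¬ P U) (hQ : ∀ T U, Sep G T U → Q T → ¬ Q U)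
    (h12 : Sep G T₁ T₂) (h13 : Sep G T₁ T₃) (h23 : Sep G T₂ T₃) : False := by
  have a := hP _ _ h12
  have b := hP _ _ h13
  have c := hP _ _ h23
  have d := hQ _ _ h12
  have e := hQ _ _ h13
  have f := hQ _ _ h23
  rcases h₁ with h₁ | h₁ <;> rcases h₂ with h₂ | h₂ <;> rcases h₃ with h₃ | h₃ <;>
    first
    | exact a h₁ h₂ | exact b h₁ h₃ | exact c h₂ h₃ | exact d h₁ h₂ | exact e h₁ h₃ | exact f h₂ h₃

theorem Sep.symm {T U : Finset V} (h : Sep G T U) : Sep G U T :=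
  fun a ha b hb => ⟨(h b hb a ha).1.symm, fun h' => (h b hb a ha).2 h'.symm⟩

theorem Sep.mono {T U T' U' : Finset V} (h : Sep G T U) (hT : T' ⊆ T) (hU : U' ⊆ U) :
    Sep G T' U' :=
  fun a ha b hb => h a (hT ha) b (hU hb)

theorem Fac.union {S T : Finset V} (hS : Fac G S) (hT : Fac G T) (h : Disjoint S T) :
    Fac G (S ∪ T) := by
  induction hS with
  | nil => simpa using hT
  | @cons S a b c hS ha hb hc hac hab hbc ih =>
    simp only [Finset.disjoint_insert_left] at h
    have := Fac.cons (ih h.2.2.2) (a := a) (b := b) (c := c) (by grind) (by grind) (by grind)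
      hac hab hbc
    simpa [Finset.insert_union] using this

theorem Fac.triple {a b c : V} (hac : a ≠ c) (hab : G.Adj a b) (hbc : G.Adj b c) :
    Fac G {a, b, c} := by
  simpa using Fac.cons Fac.nil (by simp) (by simp) (by simp) hac hab hbc

theorem Fac.exists_triple {S : Finset V} (hS : Fac G S) {v : V} (hv : v ∈ S) :
    ∃ a b c, a ≠ c ∧ G.Adj a b ∧ G.Adj b c ∧ a ∈ S ∧ b ∈ S ∧ c ∈ S ∧
      (v = a ∨ v = b ∨ v = c) ∧ Fac G (S \ {a, b, c}) := by
  induction hS with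
  | nil => simp at hv
  | @cons S a b c hS ha hb hc hac hab hbc ih =>
    by_cases h : v = a ∨ v = b ∨ v = c
    · refine ⟨a, b, c, hac, hab, hbc, by simp, by simp, by simp, h, ?_⟩
      have : insert a (insert b (insert c S)) \ {a, b, c} = S := by ext; grind
      rwa [this]
    · obtain ⟨a', b', c', h1, h2, h3, h4, h5, h6, h7, h8⟩ := ih (by grind)
      refine ⟨a', b', c', h1, h2, h3, by grind, by grind, by grind, h7, ?_⟩
      have := Fac.cons h8 (a := a) (b := b) (c := c) (by grind) (by grind) (by grind) hac hab hbc
      have e : insert a (insert b (insert c S)) \ {a', b', c'} =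
        insert a (insert b (insert c (S \ {a', b', c'}))) := by
        ext; simp only [Finset.mem_insert, Finset.mem_sdiff, Finset.mem_singleton]; grind only
      rwa [e]

/-- A leaf is an end of its path, whose middle vertex is the neighbour of the leaf. -/
theorem Fac.exists_leaf_path {S : Finset V} (hS : Fac G S) {v c : V} (hv : v ∈ S)
    (h : ∀ b ∈ S, G.Adj v b → b = c) :
    ∃ a ∈ S, a ≠ v ∧ c ∈ S ∧ G.Adj v c ∧ G.Adj c a ∧ Fac G (S \ {v, c, a}) := by
  obtain ⟨x, y, z, h1, h2, h3, h4, h5, h6, h7, h8⟩ := hS.exists_triple hv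
  rcases h7 with rfl | rfl | rfl
  · obtain rfl := h y h5 h2
    exact ⟨z, h6, h1.symm, h5, h2, h3, h8⟩
  · exact absurd ((h x h4 h2.symm).trans (h z h6 h3).symm) h1
  · obtain rfl := h y h5 h3.symm
    refine ⟨x, h4, h1, h5, h3.symm, h2.symm, ?_⟩
    have : ({v, y, x} : Finset V) = {x, y, v} := by ext; grind
    rwa [this]

/-- A closed part of a pendant set keeps its exit, so descending through closed parts ends at a
connected one. -/
theorem Pend.exists_conn {S T : Finset V} (h : Pend G S T) :
    ∃ T' ⊆ T, Pend G S T' ∧ Conn G T' := by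
  induction T using Finset.strongInduction with
  | H T ih =>
    by_cases hT : Conn G T
    · exact ⟨T, subset_rfl, h, hT⟩
    · simp only [Conn] at hT
      push Not at hT
      obtain ⟨U, hUT, hU, hcl, hn⟩ := hT
      obtain ⟨h1, h2, g, h3⟩ := h
      obtain ⟨T', hT', h'⟩ := ih U ⟨hUT, hn⟩ ⟨hUT.trans h1, hU, g, by grind⟩
      exact ⟨T', hT'.trans hUT, h'⟩

theorem Chain.of_conn_pend {S : Finset V} (hS : Conn G S)
    (h : ∀ ⦃T₁ T₂ T₃⦄, Pend G S T₁ → Pend G S T₂ → Pend G S T₃ →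
      Conn G T₁ → Conn G T₂ → Conn G T₃ →
      Sep G T₁ T₂ → Sep G T₁ T₃ → Sep G T₂ T₃ → False) : Chain G S := by
  refine ⟨hS, fun T₁ T₂ T₃ h1 h2 h3 h12 h13 h23 => ?_⟩
  obtain ⟨U₁, s1, p1, c1⟩ := h1.exists_conn
  obtain ⟨U₂, s2, p2, c2⟩ := h2.exists_conn
  obtain ⟨U₃, s3, p3, c3⟩ := h3.exists_conn
  exact h p1 p2 p3 c1 c2 c3 (h12.mono s1 s2) (h13.mono s1 s3) (h23.mono s2 s3)

theorem Conn.fac_of_card {S : Finset V} (h : Conn G S) (hc : S.card = 3) : Fac G S := by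
  obtain ⟨a, b, c, hab, hac, hbc, rfl⟩ := Finset.card_eq_three.1 hc
  -- No singleton is closed, so every vertex has a neighbour among the other two; one vertex is then
  -- adjacent to both others.
  have h1 := @h {a} (by grind) (by simp)
  have h2 := @h {b} (by grind) (by simp)
  have h3 := @h {c} (by grind) (by simp)
  have key : (G.Adj a b ∧ G.Adj b c) ∨ (G.Adj b a ∧ G.Adj a c) ∨ (G.Adj a c ∧ G.Adj c b) := by
    have e1 : ¬ ({a, b, c} : Finset V) ⊆ {a} := fun h => by grind [h (show b ∈ _ by simp)]
    have e2 : ¬ ({a, b, c} : Finset V) ⊆ {b} := fun h => by grind [h (show a ∈ _ by simp)]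
    have e3 : ¬ ({a, b, c} : Finset V) ⊆ {c} := fun h => by grind [h (show a ∈ _ by simp)]
    have f1 := fun h => e1 (h1 h)
    have f2 := fun h => e2 (h2 h)
    have f3 := fun h => e3 (h3 h)
    simp [hab, hac, hbc, hab.symm, hac.symm, hbc.symm] at f1 f2 f3
    simp only [G.adj_comm b a, G.adj_comm c a, G.adj_comm c b] at *
    tauto
  rcases key with ⟨h, h'⟩ | ⟨h, h'⟩ | ⟨h, h'⟩
  · exact Fac.triple hac h h'
  · have : ({a, b, c} : Finset V) = {b, a, c} := by ext; grind
    rw [this]; exact Fac.triple hbc h h'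
  · have : ({a, b, c} : Finset V) = {a, c, b} := by ext; grind
    rw [this]; exact Fac.triple hab h h'

/-! ### Cut vertices -/

/-- `c` is a vertex of `S` whose deletion splits `S` into `A` and `B`. -/
structure Cut (G : SimpleGraph V) (S : Finset V) (c : V) (A B : Finset V) : Prop where
  mem_iff : ∀ v, v ∈ S ↔ v = c ∨ v ∈ A ∨ v ∈ B
  notMem_left : c ∉ A
  notMem_right : c ∉ B
  nonempty_left : A.Nonempty
  nonempty_right : B.Nonempty
  sep : Sep G A B

namespace Cut

variable {S A B : Finset V} {c : V}

theorem symm (h : Cut G S c A B) : Cut G S c B A :=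
  ⟨fun v => by rw [h.mem_iff]; tauto, h.notMem_right, h.notMem_left, h.nonempty_right,
    h.nonempty_left, h.sep.symm⟩

theorem card_eq (h : Cut G S c A B) : S.card = A.card + B.card + 1 := by
  have : S = insert c (A ∪ B) := by ext v; simp [h.mem_iff]
  rw [this, Finset.card_insert_of_notMem (by simp [h.notMem_left, h.notMem_right]),
    Finset.card_union_of_disjoint]
  exact Finset.disjoint_left.2 fun a ha hb => (h.sep a ha a hb).1 rfl

theorem exists_adj (h : Cut G S c A B) (hS : Conn G S) : ∃ a ∈ A, G.Adj c a := by
  by_contra! hn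
  have hm := h.mem_iff
  have := @hS A (by grind) h.nonempty_left (fun a ha b hb hab => by
    rcases (hm b).1 hb with rfl | hb | hb
    · exact absurd hab.symm (hn a ha)
    · exact hb
    · exact absurd hab (h.sep a ha b hb).2)
  exact h.notMem_left (this ((hm c).2 (Or.inl rfl)))

/-- Otherwise `c`, `x`, `y` and a neighbour of `c` in `B` form a claw. -/
theorem adj_of_adj (h : Cut G S c A B) (hS : Conn G S) (hG : ClawFree G) {x y : V} (hx : x ∈ A)
    (hy : y ∈ A) (hcx : G.Adj c x) (hcy : G.Adj c y) (hxy : x ≠ y) : G.Adj x y := by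
  obtain ⟨b, hb, hcb⟩ := h.symm.exists_adj hS
  have h1 := h.sep x hx b hb
  have h2 := h.sep y hy b hb
  rcases hG hcx hcy hcb hxy h1.1 h2.1 with h' | h' | h'
  · exact h'
  · exact absurd h' h1.2
  · exact absurd h' h2.2

/-- The neighbours of `c` in `A` form a clique. Hence at most one of several separate pendant sets
sees `c`, and that one can absorb `c` and `B` without gaining an exit. -/
theorem chain_left (h : Cut G S c A B) (hS : Chain G S) (hG : ClawFree G) : Chain G A := by
  have hm := h.mem_iff
  have hcA := h.notMem_left
  have hsep := h.sep
  have hcl : ∀ x ∈ A, ∀ y ∈ A, G.Adj c x → G.Adj c y → x ≠ y → G.Adj x y :=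
    fun x hx y hy => h.adj_of_adj hS.1 hG hx hy
  have key : ∀ T ⊆ A, T.Nonempty → (∀ a ∈ T, ∀ b ∈ A, G.Adj a b → b ∈ T) →
      ∃ t ∈ T, G.Adj c t := by
    intro T hT hne hcl
    by_contra! hn
    have := @hS.1 T (by grind) hne (by
      intro a ha b hb hab
      rcases (hm b).1 hb with rfl | hb | hb
      · exact absurd hab.symm (hn a ha)
      · exact hcl a ha b hb hab
      · exact absurd hab (hsep a (hT ha) b hb).2)
    exact hcA (hT (this ((hm c).2 (Or.inl rfl))))
  refine ⟨fun T hT hne hc => ?_, fun T₁ T₂ T₃ h1 h2 h3 h12 h13 h23 => ?_⟩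
  · by_contra hn
    obtain ⟨t, ht, hct⟩ := key T hT hne hc
    obtain ⟨u, hu, hcu⟩ := key (A \ T) Finset.sdiff_subset
      (Finset.sdiff_nonempty.2 hn) (by
        intro a ha b hb hab
        simp only [Finset.mem_sdiff] at ha ⊢
        exact ⟨hb, fun hbT => ha.2 (hc b hbT a ha.1 hab.symm)⟩)
    simp only [Finset.mem_sdiff] at hu
    have htu : t ≠ u := by rintro rfl; exact hu.2 ht
    exact hu.2 (hc t ht u hu.1 (hcl t (hT ht) u hu.1 hct hcu htu))
  · -- a pendant set of `A` yields one of `S`, absorbing `c` and `B` if it meets `N(c)`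
    have ext0 : ∀ T, Pend G A T → (∀ t ∈ T, ¬ G.Adj c t) → Pend G S T := by
      rintro T ⟨hT, hne, g, hg⟩ hn
      refine ⟨by grind, hne, g, fun a ha b hb hab => ?_⟩
      rcases (hm b).1 hb with rfl | hb | hb
      · exact absurd hab.symm (hn a ha)
      · exact hg a ha b hb hab
      · exact absurd hab (hsep a (hT ha) b hb).2
    have ext1 : ∀ T, Pend G A T → ∀ t ∈ T, G.Adj c t → Pend G S (insert c (T ∪ B)) := by
      rintro T ⟨hT, hne, g, hg⟩ t ht hct
      refine ⟨fun v => by simp only [hm, Finset.mem_insert, Finset.mem_union]; grind,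
        ⟨c, by simp⟩, g, fun a ha b hb hab => ?_⟩
      simp only [Finset.mem_insert, Finset.mem_union] at ha ⊢
      rcases (hm b).1 hb with rfl | hb | hb
      · simp
      · rcases ha with rfl | ha | ha
        · by_cases htb : t = b
          · grind
          · have := hg t ht b hb (hcl t (hT ht) b hb hct hab htb)
            tauto
        · have := hg a ha b hb hab
          tauto
        · exact absurd hab.symm (hsep b hb a ha).2
      · tauto
    have sep1 : ∀ T U, T ⊆ A → U ⊆ A → Sep G T U → ∀ t ∈ T, G.Adj c t →
        Sep G (insert c (T ∪ B)) U ∧ ∀ u ∈ U, ¬ G.Adj c u := by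
      intro T U hT hU hTU t ht hct
      have hn : ∀ u ∈ U, ¬ G.Adj c u := fun u hu hcu =>
        (hTU t ht u hu).2 (hcl t (hT ht) u (hU hu) hct hcu (hTU t ht u hu).1)
      refine ⟨fun a ha u hu => ?_, hn⟩
      simp only [Finset.mem_insert, Finset.mem_union] at ha
      rcases ha with rfl | ha | ha
      · exact ⟨by grind, hn u hu⟩
      · exact hTU a ha u hu
      · exact (hsep.symm a ha u (hU hu))
    by_cases m1 : ∃ t ∈ T₁, G.Adj c t
    · obtain ⟨t, ht, hct⟩ := m1
      have s2 := sep1 _ _ h1.1 h2.1 h12 t ht hct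
      have s3 := sep1 _ _ h1.1 h3.1 h13 t ht hct
      exact hS.2 (ext1 _ h1 t ht hct) (ext0 _ h2 s2.2) (ext0 _ h3 s3.2) s2.1 s3.1 h23
    by_cases m2 : ∃ t ∈ T₂, G.Adj c t
    · obtain ⟨t, ht, hct⟩ := m2
      have s1 := sep1 _ _ h2.1 h1.1 h12.symm t ht hct
      have s3 := sep1 _ _ h2.1 h3.1 h23 t ht hct
      exact hS.2 (ext1 _ h2 t ht hct) (ext0 _ h1 s1.2) (ext0 _ h3 s3.2) s1.1 s3.1 h13
    by_cases m3 : ∃ t ∈ T₃, G.Adj c t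
    · obtain ⟨t, ht, hct⟩ := m3
      have s1 := sep1 _ _ h3.1 h1.1 h13.symm t ht hct
      have s2 := sep1 _ _ h3.1 h2.1 h23.symm t ht hct
      exact hS.2 (ext1 _ h3 t ht hct) (ext0 _ h1 s1.2) (ext0 _ h2 s2.2) s1.1 s2.1 h12
    push Not at m1 m2 m3
    exact hS.2 (ext0 _ h1 m1) (ext0 _ h2 m2) (ext0 _ h3 m3) h12 h13 h23

/-- Replacing the side `B` of a cut at `c` by a subset that forms a clique with `c` keeps at most
two end-blocks. -/
theorem chain_contract (h : Cut G S c A B) (hS : Chain G S) (J : Finset V) (hJ : J ⊆ B)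
    (hcJ : ∀ j ∈ J, G.Adj c j) (hJJ : ∀ i ∈ J, ∀ j ∈ J, i ≠ j → G.Adj i j) :
    Chain G (insert c (A ∪ J)) := by
  have hm := h.mem_iff
  have hcA := h.notMem_left
  have hcB := h.notMem_right
  have hsep := h.sep
  have hmem : ∀ v, v ∈ insert c (A ∪ J) ↔ v = c ∨ v ∈ A ∨ v ∈ J := by simp
  have pend0 : ∀ T, Pend G (insert c (A ∪ J)) T → (∀ t ∈ T, t ≠ c ∧ t ∉ J) → Pend G S T := by
    rintro T ⟨hT, hne, g, hg⟩ hn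
    have hTA : T ⊆ A := fun t ht => by
      have := (hmem t).1 (hT ht)
      have := hn t ht
      tauto
    refine ⟨fun t ht => (hm t).2 (Or.inr (Or.inl (hTA ht))), hne, g, fun a ha b hb hab => ?_⟩
    rcases (hm b).1 hb with rfl | hb | hb
    · exact hg a ha _ (by simp) hab
    · exact hg a ha b (by simp [hb]) hab
    · exact absurd hab (hsep a (hTA ha) b hb).2
  have pend1 : ∀ T, Pend G (insert c (A ∪ J)) T → ∀ t ∈ T, (t = c ∨ t ∈ J) →
      Pend G S (T ∪ B) := by
    rintro T ⟨hT, hne, g, hg⟩ t ht htJ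
    refine ⟨fun v hv => ?_, ⟨t, by simp [ht]⟩, g, fun a ha b hb hab => ?_⟩
    · rcases Finset.mem_union.1 hv with hv | hv
      · have := (hmem v).1 (hT hv)
        rw [hm]
        have := @hJ v
        tauto
      · exact (hm v).2 (Or.inr (Or.inr hv))
    · simp only [Finset.mem_union] at ha ⊢
      -- Edges from `B` leave only to `c`, so adding `B` costs nothing once `c` lies in `T` or is
      -- its exit already.
      have hcg : c ∈ T ∨ c = g := by
        rcases htJ with rfl | htJ
        · exact Or.inl ht
        · exact hg t ht c (by simp) (hcJ t htJ).symm
      rcases (hm b).1 hb with rfl | hb | hb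
      · tauto
      · rcases ha with ha | ha
        · have := hg a ha b (by simp [hb]) hab
          tauto
        · exact absurd hab.symm (hsep b hb a ha).2
      · tauto
  have sep1 : ∀ T U, Pend G (insert c (A ∪ J)) U → Sep G T U → ∀ t ∈ T, (t = c ∨ t ∈ J) →
      Sep G (T ∪ B) U ∧ ∀ u ∈ U, u ≠ c ∧ u ∉ J := by
    intro T U hU hTU t ht htJ
    have hn : ∀ u ∈ U, u ≠ c ∧ u ∉ J := by
      intro u hu
      have h1 := hTU t ht u hu
      constructor
      · rintro rfl
        rcases htJ with rfl | htJ
        · exact h1.1 rfl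
        · exact h1.2 (hcJ t htJ).symm
      · intro huJ
        rcases htJ with rfl | htJ
        · exact h1.2 (hcJ u huJ)
        · exact h1.2 (hJJ t htJ u huJ h1.1)
    refine ⟨fun a ha u hu => ?_, hn⟩
    rcases Finset.mem_union.1 ha with ha | ha
    · exact hTU a ha u hu
    · have h1 := (hmem u).1 (hU.1 hu)
      have h2 := hn u hu
      exact hsep.symm a ha u (by tauto)
  refine ⟨fun T hT hne hc => ?_, fun T₁ T₂ T₃ h1 h2 h3 h12 h13 h23 => ?_⟩
  · have hP : Pend G (insert c (A ∪ J)) T :=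
      ⟨hT, hne, c, fun a ha b hb hab => Or.inl (hc a ha b hb hab)⟩
    by_cases hmeet : ∃ t ∈ T, t = c ∨ t ∈ J
    · obtain ⟨t, ht, htJ⟩ := hmeet
      have hcT : c ∈ T := by
        rcases htJ with rfl | htJ
        · exact ht
        · exact hc t ht c (by simp) (hcJ t htJ).symm
      have := @hS.1 (T ∪ B) (pend1 T hP t ht htJ).1 ⟨c, by simp [hcT]⟩ (by
        intro a ha b hb hab
        simp only [Finset.mem_union] at ha ⊢
        rcases (hm b).1 hb with rfl | hb | hb
        · exact Or.inl hcT
        · rcases ha with ha | ha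
          · exact Or.inl (hc a ha b (by simp [hb]) hab)
          · exact absurd hab.symm (hsep b hb a ha).2
        · exact Or.inr hb)
      intro v hv
      rcases (hmem v).1 hv with rfl | hv | hv
      · exact hcT
      · rcases Finset.mem_union.1 (this ((hm v).2 (Or.inr (Or.inl hv)))) with h' | h'
        · exact h'
        · exact absurd rfl (hsep v hv v h').1
      · exact hc c hcT v (by simp [hv]) (hcJ v hv)
    · have hn : ∀ t ∈ T, t ≠ c ∧ t ∉ J := fun t ht =>
        ⟨fun h' => hmeet ⟨t, ht, Or.inl h'⟩, fun h' => hmeet ⟨t, ht, Or.inr h'⟩⟩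
      have hTA : T ⊆ A := fun t ht => by
        have := (hmem t).1 (hT ht)
        have := hn t ht
        tauto
      have := @hS.1 T (pend0 T hP hn).1 hne (by
        intro a ha b hb hab
        rcases (hm b).1 hb with rfl | hb | hb
        · exact hc a ha _ (by simp) hab
        · exact hc a ha b (by simp [hb]) hab
        · exact absurd hab (hsep a (hTA ha) b hb).2)
      exact absurd (hTA (this ((hm c).2 (Or.inl rfl)))) hcA
  · by_cases m1 : ∃ t ∈ T₁, t = c ∨ t ∈ J
    · obtain ⟨t, ht, hct⟩ := m1
      have s2 := sep1 _ _ h2 h12 t ht hct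
      have s3 := sep1 _ _ h3 h13 t ht hct
      exact hS.2 (pend1 _ h1 t ht hct) (pend0 _ h2 s2.2) (pend0 _ h3 s3.2) s2.1 s3.1 h23
    by_cases m2 : ∃ t ∈ T₂, t = c ∨ t ∈ J
    · obtain ⟨t, ht, hct⟩ := m2
      have s1 := sep1 _ _ h1 h12.symm t ht hct
      have s3 := sep1 _ _ h3 h23 t ht hct
      exact hS.2 (pend1 _ h2 t ht hct) (pend0 _ h1 s1.2) (pend0 _ h3 s3.2) s1.1 s3.1 h13
    by_cases m3 : ∃ t ∈ T₃, t = c ∨ t ∈ J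
    · obtain ⟨t, ht, hct⟩ := m3
      have s1 := sep1 _ _ h1 h13.symm t ht hct
      have s2 := sep1 _ _ h2 h23.symm t ht hct
      exact hS.2 (pend1 _ h3 t ht hct) (pend0 _ h1 s1.2) (pend0 _ h2 s2.2) s1.1 s2.1 h12
    push Not at m1 m2 m3
    exact hS.2 (pend0 _ h1 m1) (pend0 _ h2 m2) (pend0 _ h3 m3) h12 h13 h23

/-- In a cut of a graph without a `Λ`-factor that is minimal for this, one side has one vertex. -/
theorem fac_or_card_eq_one (h : Cut G S c A B) (hS : Chain G S) (hG : ClawFree G)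
    (h3 : 3 ∣ S.card) (ih : ∀ S', S'.card < S.card → Chain G S' → 3 ∣ S'.card → Fac G S') :
    Fac G S ∨ A.card = 1 ∨ B.card = 1 := by
  have hcard := h.card_eq
  have hA := h.nonempty_left.card_pos
  have hB := h.nonempty_right.card_pos
  have hm := h.mem_iff
  have hdisj : Disjoint A B :=
    Finset.disjoint_left.2 fun a ha hb => (h.sep a ha a hb).1 rfl
  have hcA := h.notMem_left
  have hcB := h.notMem_right
  have cA : ∀ J ⊆ B, (insert c (A ∪ J)).card = A.card + J.card + 1 := by
    intro J hJ
    rw [Finset.card_insert_of_notMem (by grind),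
      Finset.card_union_of_disjoint (hdisj.mono_right hJ)]
  have cB : ∀ J ⊆ A, (insert c (B ∪ J)).card = B.card + J.card + 1 := by
    intro J hJ
    rw [Finset.card_insert_of_notMem (by grind),
      Finset.card_union_of_disjoint (hdisj.symm.mono_right hJ)]
  -- The orders of `A` and `B` sum to 2 mod 3: one of them is divisible by three, or both are 1 mod
  -- 3.
  by_cases e1 : 3 ∣ A.card
  · left
    have f1 := ih A (by omega) (h.chain_left hS hG) e1
    -- Contracting `A` with `J = ∅` leaves just `B` and `c`.
    have f2 := ih (insert c (B ∪ ∅)) (by rw [cB ∅ (by simp)]; simp; omega)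
      (h.symm.chain_contract hS ∅ (by simp) (by simp) (by simp))
      (by rw [cB ∅ (by simp)]; simp; omega)
    have := f1.union f2 (by
      rw [Finset.union_empty, Finset.disjoint_insert_right]; exact ⟨hcA, hdisj⟩)
    convert this using 1
    ext v; simp [hm]
  by_cases e2 : 3 ∣ B.card
  · left
    have f1 := ih B (by omega) (h.symm.chain_left hS hG) e2
    have f2 := ih (insert c (A ∪ ∅)) (by rw [cA ∅ (by simp)]; simp; omega)
      (h.chain_contract hS ∅ (by simp) (by simp) (by simp))
      (by rw [cA ∅ (by simp)]; simp; omega)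
    have := f1.union f2 (by
      rw [Finset.union_empty, Finset.disjoint_insert_right]; exact ⟨hcB, hdisj.symm⟩)
    convert this using 1
    ext v; simp [hm]; tauto
  by_cases e3 : A.card = 1
  · tauto
  by_cases e4 : B.card = 1
  · tauto
  left
  -- Both orders are 1 mod 3. Each side, with `c` and one neighbour of `c` borrowed from the other
  -- side, has a factor. The borrowed vertex is a leaf, so its path is `b c a'` or `a c b'`; these
  -- two paths are replaced by the single path `a' c b'`.
  obtain ⟨a, ha, hca⟩ := h.exists_adj hS.1
  obtain ⟨b, hb, hcb⟩ := h.symm.exists_adj hS.1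
  have f1 := ih (insert c (A ∪ {b})) (by rw [cA _ (by simpa)]; simp; omega)
    (h.chain_contract hS {b} (by simpa) (by simpa) (by simp))
    (by rw [cA _ (by simpa)]; simp; omega)
  have f2 := ih (insert c (B ∪ {a})) (by rw [cB _ (by simpa)]; simp; omega)
    (h.symm.chain_contract hS {a} (by simpa) (by simpa) (by simp))
    (by rw [cB _ (by simpa)]; simp; omega)
  obtain ⟨a', ha', hab, -, -, hca', g1⟩ := f1.exists_leaf_path (v := b) (c := c) (by simp) (by
    intro v hv hbv
    simp only [Finset.mem_insert, Finset.mem_union, Finset.mem_singleton] at hv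
    rcases hv with rfl | hv | rfl
    · rfl
    · exact absurd hbv.symm (h.sep v hv b hb).2
    · exact absurd hbv (G.loopless.irrefl _))
  obtain ⟨b', hb', hba, -, -, hcb', g2⟩ := f2.exists_leaf_path (v := a) (c := c) (by simp) (by
    intro v hv hbv
    simp only [Finset.mem_insert, Finset.mem_union, Finset.mem_singleton] at hv
    rcases hv with rfl | hv | rfl
    · rfl
    · exact absurd hbv (h.sep a ha v hv).2
    · exact absurd hbv (G.loopless.irrefl _))
  have hac := hca'.ne
  have hbc := hcb'.ne
  simp only [Finset.mem_insert, Finset.mem_union, Finset.mem_singleton] at ha' hb'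
  replace ha' : a' ∈ A := by tauto
  replace hb' : b' ∈ B := by tauto
  have hd := Finset.disjoint_left.1 hdisj
  have k := hd ha'
  have k' := Finset.disjoint_right.1 hdisj hb'
  have k1 := hd ha
  have k2 := Finset.disjoint_right.1 hdisj hb
  have f3 := (g1.union g2 (by
    rw [Finset.disjoint_left]
    simp only [Finset.mem_insert, Finset.mem_union, Finset.mem_singleton, Finset.mem_sdiff]
    grind only)).union (Fac.triple (a := a') (b := c) (c := b')
      (by rintro rfl; exact k hb') hca'.symm hcb') (by
    rw [Finset.disjoint_left]
    simp only [Finset.mem_insert, Finset.mem_union, Finset.mem_singleton, Finset.mem_sdiff]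
    grind only)
  convert f3 using 1
  ext v
  have hdv := @hd v
  simp only [Finset.mem_insert, Finset.mem_union, Finset.mem_singleton, Finset.mem_sdiff, hm]
  grind only

end Cut

/-! ### Higher connectivity and two-vertex cuts -/

/-- No vertex of `S` separates the subgraph induced by `S`. -/
def Conn2 (G : SimpleGraph V) (S : Finset V) : Prop :=
  ∀ ⦃T⦄, T ⊆ S → T.Nonempty → ∀ g, (∀ a ∈ T, ∀ b ∈ S, G.Adj a b → b ∈ T ∨ b = g) →
    ∀ v ∈ S, v ∈ T ∨ v = g

/-- No two vertices of `S` separate the subgraph induced by `S`. -/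
def Conn3 (G : SimpleGraph V) (S : Finset V) : Prop :=
  ∀ ⦃T⦄, T ⊆ S → T.Nonempty → ∀ g h,
    (∀ a ∈ T, ∀ b ∈ S, G.Adj a b → b ∈ T ∨ b = g ∨ b = h) → ∀ v ∈ S, v ∈ T ∨ v = g ∨ v = h

/-- Connectivity forces the exit to be a genuine vertex of `S` outside `T`, since otherwise `T`
would be closed. -/
theorem Conn.cut_of_exit {S T : Finset V} (h : Conn G S) (hT : T ⊆ S) (hne : T.Nonempty) {g v : V}
    (hg : ∀ a ∈ T, ∀ b ∈ S, G.Adj a b → b ∈ T ∨ b = g) (hv : v ∈ S) (hvT : v ∉ T) (hvg : v ≠ g) :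
    Cut G S g T (S \ insert g T) := by
  have hgS : g ∈ S ∧ g ∉ T := by
    by_contra hn
    exact hvT (h hT hne (fun a ha b hb hab => by
      rcases hg a ha b hb hab with h' | rfl
      · exact h'
      · by_contra h''; exact hn ⟨hb, h''⟩) hv)
  refine ⟨?_, hgS.2, by simp, hne, ⟨v, by simp [*]⟩, ?_⟩
  · intro w
    simp only [Finset.mem_sdiff, Finset.mem_insert]
    by_cases w = g <;> by_cases w ∈ T <;> grind
  · intro a ha b hb
    simp only [Finset.mem_sdiff, Finset.mem_insert] at hb
    refine ⟨fun h' => hb.2 (Or.inr (h' ▸ ha)), fun hab => ?_⟩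
    have := hg a ha b hb.1 hab
    tauto

theorem Conn.exists_cut {S : Finset V} (h : Conn G S) (h2 : ¬ Conn2 G S) :
    ∃ c A B, Cut G S c A B := by
  simp only [Conn2] at h2
  push Not at h2
  obtain ⟨T, hT, hne, g, hg, v, hv, hvT, hvg⟩ := h2
  exact ⟨g, _, _, h.cut_of_exit hT hne hg hv hvT hvg⟩

theorem Cut.exists_leaf {S A B : Finset V} {c : V} (h : Cut G S c A B) (hS : Conn G S)
    (hA : A.card = 1) : ∃ l ∈ S, A = {l} ∧ G.Adj l c ∧ ∀ b ∈ S, G.Adj l b → b = c := by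
  obtain ⟨l, rfl⟩ := Finset.card_eq_one.1 hA
  obtain ⟨a, ha, hca⟩ := h.exists_adj hS
  rw [Finset.mem_singleton] at ha
  subst ha
  have hm := h.mem_iff
  refine ⟨a, (hm a).2 (by simp), rfl, hca.symm, fun b hb hab => ?_⟩
  rcases (hm b).1 hb with h' | h' | h'
  · exact h'
  · exact absurd (Finset.mem_singleton.1 h') hab.ne'
  · exact absurd hab (h.sep a (by simp) b h').2

/-- `x` and `y` are two vertices of `S` whose deletion splits `S` into `A` and `B`. -/
structure Cut2 (G : SimpleGraph V) (S : Finset V) (x y : V) (A B : Finset V) : Prop where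
  mem_iff : ∀ v, v ∈ S ↔ v = x ∨ v = y ∨ v ∈ A ∨ v ∈ B
  ne : x ≠ y
  x_notMem_left : x ∉ A
  x_notMem_right : x ∉ B
  y_notMem_left : y ∉ A
  y_notMem_right : y ∉ B
  nonempty_left : A.Nonempty
  nonempty_right : B.Nonempty
  sep : Sep G A B

theorem Conn2.exists_cut2 {S : Finset V} (h : Conn2 G S) (h3 : ¬ Conn3 G S) :
    ∃ x y A B, Cut2 G S x y A B := by
  simp only [Conn3] at h3
  push Not at h3
  obtain ⟨T, hT, hne, x, y, hg, v, hv, hvT, hvx, hvy⟩ := h3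
  have hx : x ∈ S ∧ x ∉ T ∧ x ≠ y := by
    by_contra hn
    have := h hT hne y (fun a ha b hb hab => by have := hg a ha b hb hab; grind) v hv
    tauto
  have hy : y ∈ S ∧ y ∉ T := by
    by_contra hn
    have := h hT hne x (fun a ha b hb hab => by have := hg a ha b hb hab; grind) v hv
    tauto
  refine ⟨x, y, T, S \ insert x (insert y T), ?_, hx.2.2, hx.2.1, by simp, hy.2, by simp, hne,
    ⟨v, by simp [*]⟩, ?_⟩
  · intro w
    simp only [Finset.mem_sdiff, Finset.mem_insert]
    have := @hT w
    grind
  · intro a ha b hb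
    simp only [Finset.mem_sdiff, Finset.mem_insert] at hb
    refine ⟨fun h' => hb.2 (Or.inr (Or.inr (h' ▸ ha))), fun hab => ?_⟩
    have := hg a ha b hb.1 hab
    tauto

namespace Cut2

variable {S A B : Finset V} {x y : V}

theorem symm (h : Cut2 G S x y A B) : Cut2 G S x y B A :=
  ⟨fun v => by rw [h.mem_iff]; tauto, h.ne, h.x_notMem_right, h.x_notMem_left, h.y_notMem_right,
    h.y_notMem_left, h.nonempty_right, h.nonempty_left, h.sep.symm⟩

theorem swap (h : Cut2 G S x y A B) : Cut2 G S y x A B :=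
  ⟨fun v => by rw [h.mem_iff]; tauto, h.ne.symm, h.y_notMem_left, h.y_notMem_right,
    h.x_notMem_left, h.x_notMem_right, h.nonempty_left, h.nonempty_right, h.sep⟩

/-- A union of components of `A` is adjacent to both cut vertices. -/
theorem exists_adj (h : Cut2 G S x y A B) (hS : Conn2 G S) {T : Finset V} (hT : T ⊆ A)
    (hne : T.Nonempty) (hc : ∀ a ∈ T, ∀ b ∈ A, G.Adj a b → b ∈ T) : ∃ t ∈ T, G.Adj x t := by
  by_contra! hn
  have hm := h.mem_iff
  have := @hS T (fun v hv => (hm v).2 (by have := hT hv; tauto)) hne y (by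
    intro a ha b hb hab
    rcases (hm b).1 hb with rfl | rfl | hb | hb
    · exact absurd hab.symm (hn a ha)
    · exact Or.inr rfl
    · exact Or.inl (hc a ha b hb hab)
    · exact absurd hab (h.sep a (hT ha) b hb).2) x ((hm x).2 (Or.inl rfl))
  rcases this with h' | h'
  · exact h.x_notMem_left (hT h')
  · exact h.ne h'

theorem adj_of_adj (h : Cut2 G S x y A B) (hS : Conn2 G S) (hG : ClawFree G) {v w : V}
    (hv : v ∈ A) (hw : w ∈ A) (hxv : G.Adj x v) (hxw : G.Adj x w) (hvw : v ≠ w) : G.Adj v w := by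
  obtain ⟨b, hb, hxb⟩ := h.symm.exists_adj hS subset_rfl h.nonempty_right (fun _ _ _ h _ => h)
  have h1 := h.sep v hv b hb
  have h2 := h.sep w hw b hb
  rcases hG hxv hxw hxb hvw h1.1 h2.1 with h' | h' | h'
  · exact h'
  · exact absurd h' h1.2
  · exact absurd h' h2.2

theorem not_adj_of_sep (h : Cut2 G S x y A B) (hS : Conn2 G S) (hG : ClawFree G) {T U : Finset V}
    (hTU : Sep G T U) : (∃ t ∈ T, t ∈ A ∧ G.Adj x t) → ¬ ∃ u ∈ U, u ∈ A ∧ G.Adj x u := by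
  rintro ⟨t, ht, htA, hxt⟩ ⟨u, hu, huA, hxu⟩
  have := hTU t ht u hu
  exact this.2 (h.adj_of_adj hS hG htA huA hxt hxu this.1)

/-- A pendant set of `A` that saw neither `x` nor `y` would be pendant in `S`. Two separate ones
cannot both see `x`, whose neighbours in `A` form a clique; likewise for `y`. -/
theorem chain_left (h : Cut2 G S x y A B) (hS : Conn2 G S) (hG : ClawFree G) : Chain G A := by
  have hm := h.mem_iff
  refine ⟨fun T hT hne hc => ?_, fun T₁ T₂ T₃ h1 h2 h3 h12 h13 h23 => ?_⟩
  · by_contra hn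
    have hc' : ∀ a ∈ A \ T, ∀ b ∈ A, G.Adj a b → b ∈ A \ T := by
      intro a ha b hb hab
      simp only [Finset.mem_sdiff] at ha ⊢
      exact ⟨hb, fun hbT => ha.2 (hc b hbT a ha.1 hab.symm)⟩
    obtain ⟨t, ht, hxt⟩ := h.exists_adj hS hT hne hc
    obtain ⟨u, hu, hxu⟩ := h.exists_adj hS Finset.sdiff_subset (Finset.sdiff_nonempty.2 hn) hc'
    rw [Finset.mem_sdiff] at hu
    have htu : t ≠ u := by rintro rfl; exact hu.2 ht
    exact hu.2 (hc t ht u hu.1 (h.adj_of_adj hS hG (hT ht) hu.1 hxt hxu htu))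
  · have key : ∀ T, Pend G A T → (∃ t ∈ T, G.Adj x t) ∨ ∃ t ∈ T, G.Adj y t := by
      rintro T ⟨hT, hne, g, hg⟩
      by_contra! hn
      have := @hS T (fun v hv => (hm v).2 (by have := hT hv; tauto)) hne g (by
        intro a ha b hb hab
        rcases (hm b).1 hb with rfl | rfl | hb | hb
        · exact absurd hab.symm (hn.1 a ha)
        · exact absurd hab.symm (hn.2 a ha)
        · exact hg a ha b hb hab
        · exact absurd hab (h.sep a (hT ha) b hb).2)
      have hx := this x ((hm x).2 (by tauto))
      have hy := this y ((hm y).2 (by tauto))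
      have := h.ne
      have := @hT x
      have := @hT y
      have := h.x_notMem_left
      have := h.y_notMem_left
      grind
    have key' : ∀ T, Pend G A T → (∃ t ∈ T, t ∈ A ∧ G.Adj x t) ∨ ∃ t ∈ T, t ∈ A ∧ G.Adj y t := by
      intro T hT
      rcases key T hT with ⟨t, ht, h'⟩ | ⟨t, ht, h'⟩
      · exact Or.inl ⟨t, ht, hT.1 ht, h'⟩
      · exact Or.inr ⟨t, ht, hT.1 ht, h'⟩
    exact false_of_three_of_two (key' _ h1) (key' _ h2) (key' _ h3)
      (fun _ _ => h.not_adj_of_sep hS hG) (fun _ _ => h.swap.not_adj_of_sep hS hG) h12 h13 h23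

/-- The two places are now the vertex `x` itself and the clique of neighbours of `y` in `A`. -/
theorem chain_insert (h : Cut2 G S x y A B) (hS : Conn2 G S) (hG : ClawFree G) :
    Chain G (insert x A) := by
  have hm := h.mem_iff
  have hxA := h.x_notMem_left
  have key : ∀ T, Pend G (insert x A) T → x ∈ T ∨ ∃ t ∈ T, G.Adj y t := by
    rintro T ⟨hT, hne, g, hg⟩
    by_contra! hn
    have hTA : T ⊆ A := fun t ht => by
      rcases Finset.mem_insert.1 (hT ht) with rfl | h'
      · exact absurd ht hn.1
      · exact h'
    have := @hS T (fun v hv => (hm v).2 (by have := hTA hv; tauto)) hne g (by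
      intro a ha b hb hab
      rcases (hm b).1 hb with rfl | rfl | hb | hb
      · exact hg a ha _ (by simp) hab
      · exact absurd hab.symm (hn.2 a ha)
      · exact hg a ha b (by simp [hb]) hab
      · exact absurd hab (h.sep a (hTA ha) b hb).2)
    have hy := this y ((hm y).2 (by tauto))
    obtain ⟨b, hb⟩ := h.nonempty_right
    have hb' := this b ((hm b).2 (by tauto))
    have k1 := @hTA y
    have k2 := h.y_notMem_left
    have k3 := h.y_notMem_right
    have k4 : b ∉ T := fun h' => (h.sep b (hTA h') b hb).1 rfl
    grind
  refine ⟨fun T hT hne hc => ?_, fun T₁ T₂ T₃ h1 h2 h3 h12 h13 h23 => ?_⟩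
  · have side : ∀ U ⊆ insert x A, U.Nonempty → (∀ a ∈ U, ∀ b ∈ insert x A, G.Adj a b → b ∈ U) →
        x ∈ U := by
      intro U hU hUne hUc
      by_contra hx
      have hUA : U ⊆ A := fun t ht => by
        rcases Finset.mem_insert.1 (hU ht) with rfl | h'
        · exact absurd ht hx
        · exact h'
      obtain ⟨u, hu, hxu⟩ := h.exists_adj hS hUA hUne
        (fun a ha b hb => hUc a ha b (by simp [hb]))
      exact hx (hUc u hu x (by simp) hxu.symm)
    by_contra hn
    have h1 := side T hT hne hc
    have h2 := side (insert x A \ T) Finset.sdiff_subset (Finset.sdiff_nonempty.2 hn) (by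
      intro a ha b hb hab
      rw [Finset.mem_sdiff] at ha ⊢
      exact ⟨hb, fun hbT => ha.2 (hc b hbT a ha.1 hab.symm)⟩)
    exact (Finset.mem_sdiff.1 h2).2 h1
  · have key' : ∀ T, Pend G (insert x A) T → x ∈ T ∨ ∃ t ∈ T, t ∈ A ∧ G.Adj y t := by
      intro T hT
      by_cases hx : x ∈ T
      · exact Or.inl hx
      · obtain ⟨t, ht, hyt⟩ := (key T hT).resolve_left hx
        rcases Finset.mem_insert.1 (hT.1 ht) with rfl | h'
        · exact absurd ht hx
        · exact Or.inr ⟨t, ht, h', hyt⟩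
    exact false_of_three_of_two (key' _ h1) (key' _ h2) (key' _ h3)
      (fun T U h a b => (h x a x b).1 rfl) (fun _ _ => h.swap.not_adj_of_sep hS hG) h12 h13 h23

/-- With both cut vertices present, every pendant set contains one of them; claw-freeness plays no
role. -/
theorem chain_insert_insert (h : Cut2 G S x y A B) (hS : Conn2 G S) :
    Chain G (insert x (insert y A)) := by
  have hm := h.mem_iff
  have hmem : ∀ v, v ∈ insert x (insert y A) ↔ v = x ∨ v = y ∨ v ∈ A := by simp
  have key : ∀ T, Pend G (insert x (insert y A)) T → x ∈ T ∨ y ∈ T := by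
    rintro T ⟨hT, hne, g, hg⟩
    by_contra! hn
    have hTA : T ⊆ A := fun t ht => by
      rcases (hmem t).1 (hT ht) with rfl | rfl | h'
      · exact absurd ht hn.1
      · exact absurd ht hn.2
      · exact h'
    have := @hS T (fun v hv => (hm v).2 (by have := hTA hv; tauto)) hne g (by
      intro a ha b hb hab
      rcases (hm b).1 hb with rfl | rfl | hb | hb
      · exact hg a ha _ (by simp) hab
      · exact hg a ha _ (by simp) hab
      · exact hg a ha b (by simp [hb]) hab
      · exact absurd hab (h.sep a (hTA ha) b hb).2)
    have hx := this x ((hm x).2 (by tauto))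
    have hy := this y ((hm y).2 (by tauto))
    have := h.ne
    grind
  refine ⟨fun T hT hne hc => ?_, fun T₁ T₂ T₃ h1 h2 h3 h12 h13 h23 => ?_⟩
  · by_contra hn
    have hc' : ∀ a ∈ insert x (insert y A) \ T, ∀ b ∈ insert x (insert y A), G.Adj a b →
        b ∈ insert x (insert y A) \ T := by
      intro a ha b hb hab
      rw [Finset.mem_sdiff] at ha ⊢
      exact ⟨hb, fun hbT => ha.2 (hc b hbT a ha.1 hab.symm)⟩
    -- each side meets `A`, in a union of components, so contains both cut vertices
    obtain ⟨v, hv⟩ := h.nonempty_left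
    have main : ∀ U ⊆ insert x (insert y A), v ∈ U →
        (∀ a ∈ U, ∀ b ∈ insert x (insert y A), G.Adj a b → b ∈ U) → x ∈ U ∧ y ∈ U := by
      intro U hU hvU hUc
      have hcl : ∀ a ∈ U ∩ A, ∀ b ∈ A, G.Adj a b → b ∈ U ∩ A := by
        intro a ha b hb hab
        rw [Finset.mem_inter] at ha ⊢
        exact ⟨hUc a ha.1 b ((hmem b).2 (by tauto)) hab, hb⟩
      have hne' : (U ∩ A).Nonempty := ⟨v, by simp [hvU, hv]⟩
      obtain ⟨u, hu, hxu⟩ := h.exists_adj hS Finset.inter_subset_right hne' hcl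
      obtain ⟨w, hw, hyw⟩ := h.swap.exists_adj hS Finset.inter_subset_right hne' hcl
      rw [Finset.mem_inter] at hu hw
      exact ⟨hUc u hu.1 x (by simp) hxu.symm, hUc w hw.1 y (by simp) hyw.symm⟩
    have fin : ∀ U ⊆ insert x (insert y A), v ∈ U →
        (∀ a ∈ U, ∀ b ∈ insert x (insert y A), G.Adj a b → b ∈ U) →
        insert x (insert y A) ⊆ U := by
      intro U hU hvU hUc
      by_contra hn
      obtain ⟨hxU, hyU⟩ := main U hU hvU hUc
      obtain ⟨w, hw, hwU⟩ := Finset.not_subset.1 hn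
      have hcl : ∀ a ∈ A \ U, ∀ b ∈ A, G.Adj a b → b ∈ A \ U := by
        intro a ha b hb hab
        rw [Finset.mem_sdiff] at ha ⊢
        exact ⟨hb, fun hbT => ha.2 (hUc b hbT a ((hmem a).2 (by tauto)) hab.symm)⟩
      have hwA : w ∈ A := by
        rcases (hmem w).1 hw with rfl | rfl | h'
        · exact absurd hxU hwU
        · exact absurd hyU hwU
        · exact h'
      obtain ⟨u, hu, hxu⟩ := h.exists_adj hS Finset.sdiff_subset ⟨w, by simp [hwA, hwU]⟩ hcl
      rw [Finset.mem_sdiff] at hu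
      exact hu.2 (hUc x hxU u ((hmem u).2 (by tauto)) hxu)
    by_cases hvT : v ∈ T
    · exact hn (fin T hT hvT hc)
    · have := fin _ Finset.sdiff_subset (by rw [Finset.mem_sdiff]; exact ⟨by simp [hv], hvT⟩) hc'
      obtain ⟨t, ht⟩ := hne
      exact (Finset.mem_sdiff.1 (this (hT ht))).2 ht
  · exact false_of_three_of_two (key _ h1) (key _ h2) (key _ h3)
      (fun T U h a b => (h x a x b).1 rfl) (fun T U h a b => (h y a y b).1 rfl) h12 h13 h23

theorem fac (h : Cut2 G S x y A B) (hS : Conn2 G S) (hG : ClawFree G)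
    (h3 : 3 ∣ S.card) (ih : ∀ S', S'.card < S.card → Chain G S' → 3 ∣ S'.card → Fac G S') :
    Fac G S := by
  have hm := h.mem_iff
  have hA := h.nonempty_left.card_pos
  have hB := h.nonempty_right.card_pos
  have hdisj : Disjoint A B :=
    Finset.disjoint_left.2 fun a ha hb => (h.sep a ha a hb).1 rfl
  have hne := h.ne
  have xA := h.x_notMem_left
  have xB := h.x_notMem_right
  have yA := h.y_notMem_left
  have yB := h.y_notMem_right
  have hcard : S.card = A.card + B.card + 2 := by
    have : S = insert x (insert y (A ∪ B)) := by ext v; simp [hm]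
    rw [this, Finset.card_insert_of_notMem (by simp [hne, xA, xB]),
      Finset.card_insert_of_notMem (by simp [yA, yB]), Finset.card_union_of_disjoint hdisj]
  have cxA : (insert x A).card = A.card + 1 := Finset.card_insert_of_notMem xA
  have cyB : (insert y B).card = B.card + 1 := Finset.card_insert_of_notMem yB
  have cxyA : (insert x (insert y A)).card = A.card + 2 := by
    rw [Finset.card_insert_of_notMem (by simp [hne, xA]), Finset.card_insert_of_notMem yA]
  have cxyB : (insert x (insert y B)).card = B.card + 2 := by
    rw [Finset.card_insert_of_notMem (by simp [hne, xB]), Finset.card_insert_of_notMem yB]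
  -- The orders of `A` and `B` sum to 1 mod 3. If neither is divisible by three, both are 2 mod 3,
  -- and each side takes one cut vertex.
  by_cases e1 : 3 ∣ A.card
  · have f := (ih A (by omega) (h.chain_left hS hG) e1).union
      (ih _ (by omega) (h.symm.chain_insert_insert hS) (by omega))
      (by simp [Finset.disjoint_insert_right, *])
    convert f using 1
    ext v; simp [hm]
  by_cases e2 : 3 ∣ B.card
  · have f := (ih B (by omega) (h.symm.chain_left hS hG) e2).union
      (ih _ (by omega) (h.chain_insert_insert hS) (by omega))
      (by simp [Finset.disjoint_insert_right, hdisj.symm, *])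
    convert f using 1
    ext v; simp [hm]; tauto
  · have f := (ih _ (by omega) (h.chain_insert hS hG) (by omega)).union
      (ih _ (by omega) (h.swap.symm.chain_insert hS hG) (by omega))
      (by simp [Finset.disjoint_insert_right, Finset.disjoint_insert_left, hne.symm, *])
    convert f using 1
    ext v; simp [hm]; tauto

end Cut2

/-! ### Deleting one vertex, and the descent on splits -/

/-- In a connected set, an edge leaves every proper nonempty subset. -/
theorem Conn.exists_exit {T X : Finset V} (h : Conn G T) (hX : ∃ a ∈ X, a ∈ T)
    (hT : ∃ b ∈ T, b ∉ X) : ∃ a ∈ T, a ∈ X ∧ ∃ b ∈ T, b ∉ X ∧ G.Adj a b := by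
  by_contra! hn
  obtain ⟨a, haX, haT⟩ := hX
  obtain ⟨b, hbT, hbX⟩ := hT
  have := @h (T ∩ X) Finset.inter_subset_left ⟨a, by simp [haX, haT]⟩ (by
    intro a ha b hb hab
    rw [Finset.mem_inter] at ha ⊢
    by_contra h'
    exact hn a ha.1 ha.2 b hb (fun h'' => h' ⟨hb, h''⟩) hab)
  exact hbX (Finset.mem_inter.1 (this hbT)).2

/-- Deleting a vertex from a 2-connected claw-free graph leaves at most two end-blocks. -/
theorem Conn2.chain_erase {D : Finset V} (h : Conn2 G D) (hG : ClawFree G) (z : V) :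
    Chain G (D.erase z) := by
  refine ⟨fun T hT hne hc v hv => ?_, fun T₁ T₂ T₃ h1 h2 h3 h12 h13 h23 => ?_⟩
  · rw [Finset.mem_erase] at hv
    refine (h (hT.trans (Finset.erase_subset _ _)) hne z ?_ v hv.2).resolve_right hv.1
    intro a ha b hb hab
    by_cases hbz : b = z
    · exact Or.inr hbz
    · exact Or.inl (hc a ha b (by simp [hbz, hb]) hab)
  -- If `T` missed `z`, it would have a single exit in `D`, and `Conn2` would identify a vertex of
  -- `U` and one of `W` with that exit. So all three sets see `z`, which gives a claw.
  · have key : ∀ T U W, Pend G (D.erase z) T → Pend G (D.erase z) U → Pend G (D.erase z) W →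
        Sep G T U → Sep G T W → Sep G U W → ∃ t ∈ T, G.Adj z t := by
      rintro T U W ⟨hT, hne, g, hg⟩ ⟨hU, ⟨u, hu⟩, -⟩ ⟨hW, ⟨w, hw⟩, -⟩ hTU hTW hUW
      by_contra! hn
      have := h (hT.trans (Finset.erase_subset _ _)) hne g (by
        intro a ha b hb hab
        refine hg a ha b (Finset.mem_erase.2 ⟨?_, hb⟩) hab
        rintro rfl
        exact hn a ha hab.symm)
      have hu' := this u (Finset.mem_of_mem_erase (hU hu))
      have hw' := this w (Finset.mem_of_mem_erase (hW hw))
      have a1 : u ∉ T := fun h' => (hTU u h' u hu).1 rfl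
      have a2 : w ∉ T := fun h' => (hTW w h' w hw).1 rfl
      exact (hUW u hu w hw).1 ((hu'.resolve_left a1).trans (hw'.resolve_left a2).symm)
    obtain ⟨a, ha, hza⟩ := key _ _ _ h1 h2 h3 h12 h13 h23
    obtain ⟨b, hb, hzb⟩ := key _ _ _ h2 h1 h3 h12.symm h23 h13
    obtain ⟨c, hc, hzc⟩ := key _ _ _ h3 h1 h2 h13.symm h23.symm h12
    have hab := h12 a ha b hb
    have hac := h13 a ha c hc
    have hbc := h23 b hb c hc
    rcases hG hza hzb hzc hab.1 hac.1 hbc.1 with h' | h' | h'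
    · exact hab.2 h'
    · exact hac.2 h'
    · exact hbc.2 h'

/-- The vertex `z` of the pendant set `P` of `D`, when deleted, splits off two end-blocks
`T₁`, `T₂` inside `P`: the first sees `x` but not `y`, the second `y` but not `x`. -/
structure Split (G : SimpleGraph V) (D P : Finset V) (x y z : V) (T₁ T₂ : Finset V) : Prop where
  subset₁ : T₁ ⊆ P.erase z
  subset₂ : T₂ ⊆ P.erase z
  conn₁ : Conn G T₁
  conn₂ : Conn G T₂
  sep : Sep G T₁ T₂
  exit₁ : ∃ g, ∀ a ∈ T₁, ∀ b ∈ D, G.Adj a b → b ∈ T₁ ∨ b = z ∨ b = g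
  exit₂ : ∃ g, ∀ a ∈ T₂, ∀ b ∈ D, G.Adj a b → b ∈ T₂ ∨ b = z ∨ b = g
  x₁ : ∃ t ∈ T₁, G.Adj x t
  z₁ : ∃ t ∈ T₁, G.Adj z t
  y₂ : ∃ t ∈ T₂, G.Adj y t
  z₂ : ∃ t ∈ T₂, G.Adj z t
  not_y₁ : ∀ t ∈ T₁, ¬ G.Adj y t
  not_x₂ : ∀ t ∈ T₂, ¬ G.Adj x t

/-- The second exit `g₂` of `T₂` turns out to lie in `U₁`, hence not in `U₂`. If also `z ∉ U₂`, the
connected set `U₂` meets `T₂` and has no way out of it; it is proper because it misses `z'`. -/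
theorem Split.exists_smaller {D P : Finset V} {x y : V} (hD : Conn G D) (hPD : P ⊆ D)
    (hPne : P ≠ D)
    (hx : ∀ a ∈ P, ∀ b ∈ P, G.Adj x a → G.Adj x b → a ≠ b → G.Adj a b)
    {z z' : V} {T₁ T₂ U₁ U₂ : Finset V} (hyz : G.Adj y z)
    (h : Split G D P x y z T₁ T₂) (hz' : z' ∈ T₂) (h' : Split G D P x y z' U₁ U₂) :
    U₂ ⊂ T₂ := by
  obtain ⟨g₁, hg₁⟩ := h.exit₁
  obtain ⟨g₂, hg₂⟩ := h.exit₂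
  obtain ⟨k₁, hk₁⟩ := h'.exit₁
  obtain ⟨k₂, hk₂⟩ := h'.exit₂
  obtain ⟨p, hp, hxp⟩ := h.x₁
  obtain ⟨p', hp', hxp'⟩ := h'.x₁
  have s1 : ∀ t ∈ T₁, t ≠ z ∧ t ∈ P := fun t ht => Finset.mem_erase.1 (h.subset₁ ht)
  have s2 : ∀ t ∈ T₂, t ≠ z ∧ t ∈ P := fun t ht => Finset.mem_erase.1 (h.subset₂ ht)
  have r1 : ∀ t ∈ U₁, t ≠ z' ∧ t ∈ P := fun t ht => Finset.mem_erase.1 (h'.subset₁ ht)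
  have r2 : ∀ t ∈ U₂, t ≠ z' ∧ t ∈ P := fun t ht => Finset.mem_erase.1 (h'.subset₂ ht)
  have hzU₁ : z ∉ U₁ := fun hz => h'.not_y₁ z hz hyz
  have hz'T₁ : z' ∉ T₁ := fun hz => (h.sep z' hz z' hz').1 rfl
  have hp'T₂ : p' ∉ T₂ := fun hh => h.not_x₂ p' hh hxp'
  have hpU₂ : p ∉ U₂ := fun hh => h'.not_x₂ p hh hxp
  -- `U₁` sees `x` and `T₂` does not, so `U₁` is not inside `T₂`. It reaches from `T₂` or its vertex
  -- `z'` to the outside, and since `z ∉ U₁` it must use `g₂`.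
  have hg₂' : g₂ ∈ U₁ ∧ ∃ t ∈ T₂, G.Adj t g₂ := by
    by_cases hm : ∃ a ∈ T₂, a ∈ U₁
    · obtain ⟨a, haU, haT, b, hbU, hbT, hab⟩ := h'.conn₁.exists_exit hm ⟨p', hp', hp'T₂⟩
      rcases hg₂ a haT b (hPD (r1 b hbU).2) hab with h1 | rfl | rfl
      · exact absurd h1 hbT
      · exact absurd hbU hzU₁
      · exact ⟨hbU, a, haT, hab⟩
    · obtain ⟨t, ht, hzt⟩ := h'.z₁
      rcases hg₂ z' hz' t (hPD (r1 t ht).2) hzt with h1 | rfl | rfl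
      · exact absurd ⟨t, h1, ht⟩ hm
      · exact absurd ht hzU₁
      · exact ⟨ht, z', hz', hzt⟩
  obtain ⟨hg₂U, w, hw, hwg⟩ := hg₂'
  have hg₂U₂ : g₂ ∉ U₂ := fun hh => (h'.sep g₂ hg₂U g₂ hh).1 rfl
  have hg₂T₁ : g₂ ∉ T₁ := fun hh => (h.sep g₂ hh w hw).2 hwg.symm
  -- If `z ∈ U₂`, all exits of the four sets fall back into their union: `g₁` and `g₂` into `U₁`,
  -- `k₁` and `k₂` into `T₁`, `z` into `U₂`, `z'` into `T₂`. The union is then all of `D`, although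
  -- it lies in `P`.
  by_cases hzU : z ∈ U₂
  · exfalso
    obtain ⟨s, hs, hzs⟩ := h.z₁
    have hsU₁ : s ∉ U₁ := fun hh => (h'.sep s hh z hzU).2 hzs.symm
    have hpp : p ≠ p' → G.Adj p p' := fun hne => hx p (s1 p hp).2 p' (r1 p' hp').2 hxp hxp' hne
    have e1 : k₁ ∈ T₁ := by
      by_cases hm : ∃ a ∈ U₁, a ∈ T₁
      · obtain ⟨a, ha, haU, b, hb, hbU, hab⟩ := h.conn₁.exists_exit hm ⟨s, hs, hsU₁⟩
        rcases hk₁ a haU b (hPD (s1 b hb).2) hab with h1 | rfl | rfl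
        · exact absurd h1 hbU
        · exact absurd hb hz'T₁
        · exact hb
      · have hne : p ≠ p' := by rintro rfl; exact hm ⟨p, hp', hp⟩
        rcases hk₁ p' hp' p (hPD (s1 p hp).2) (hpp hne).symm with h1 | rfl | rfl
        · exact absurd ⟨p, h1, hp⟩ hm
        · exact absurd hp hz'T₁
        · exact hp
    have e2 : g₁ ∈ U₁ := by
      by_cases hm : ∃ a ∈ T₁, a ∈ U₁
      · obtain ⟨a, ha, haU, b, hb, hbU, hab⟩ := h'.conn₁.exists_exit hm ⟨g₂, hg₂U, hg₂T₁⟩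
        rcases hg₁ a haU b (hPD (r1 b hb).2) hab with h1 | rfl | rfl
        · exact absurd h1 hbU
        · exact absurd hb hzU₁
        · exact hb
      · have hne : p ≠ p' := by rintro rfl; exact hm ⟨p, hp, hp'⟩
        rcases hg₁ p hp p' (hPD (r1 p' hp').2) (hpp hne) with h1 | rfl | rfl
        · exact absurd ⟨p', h1, hp'⟩ hm
        · exact absurd hp' hzU₁
        · exact hp'
    have e3 : k₂ ∈ T₁ := by
      by_cases hm : ∃ a ∈ U₂, a ∈ T₁
      · obtain ⟨a, ha, haU, b, hb, hbU, hab⟩ := h.conn₁.exists_exit hm ⟨p, hp, hpU₂⟩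
        rcases hk₂ a haU b (hPD (s1 b hb).2) hab with h1 | rfl | rfl
        · exact absurd h1 hbU
        · exact absurd hb hz'T₁
        · exact hb
      · rcases hk₂ z hzU s (hPD (s1 s hs).2) hzs with h1 | rfl | rfl
        · exact absurd ⟨s, h1, hs⟩ hm
        · exact absurd hs hz'T₁
        · exact hs
    have hsub : T₁ ∪ U₁ ∪ U₂ ∪ T₂ ⊆ P := by
      intro v hv
      simp only [Finset.mem_union] at hv
      rcases hv with ((hv | hv) | hv) | hv
      · exact (s1 v hv).2
      · exact (r1 v hv).2
      · exact (r2 v hv).2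
      · exact (s2 v hv).2
    have := @hD (T₁ ∪ U₁ ∪ U₂ ∪ T₂) (hsub.trans hPD) ⟨p, by simp [hp]⟩ (by
      intro a ha b hb hab
      simp only [Finset.mem_union] at ha ⊢
      rcases ha with ((ha | ha) | ha) | ha
      · rcases hg₁ a ha b hb hab with h1 | rfl | rfl <;> tauto
      · rcases hk₁ a ha b hb hab with h1 | rfl | rfl <;> tauto
      · rcases hk₂ a ha b hb hab with h1 | rfl | rfl <;> tauto
      · rcases hg₂ a ha b hb hab with h1 | rfl | rfl <;> tauto)
    exact hPne (hPD.antisymm (this.trans hsub))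
  · have hsub : U₂ ⊆ T₂ := by
      by_contra hn
      obtain ⟨v, hv, hvT⟩ := Finset.not_subset.1 hn
      obtain ⟨t, ht, hzt⟩ := h'.z₂
      have htT : t ∈ T₂ := by
        rcases hg₂ z' hz' t (hPD (r2 t ht).2) hzt with h1 | rfl | rfl
        · exact h1
        · exact absurd ht hzU
        · exact absurd ht hg₂U₂
      obtain ⟨a, ha, haU, b, hb, hbU, hab⟩ := h'.conn₂.exists_exit ⟨t, htT, ht⟩ ⟨v, hv, hvT⟩
      rcases hg₂ a haU b (hPD (r2 b hb).2) hab with h1 | rfl | rfl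
      · exact hbU h1
      · exact hzU hb
      · exact hg₂U₂ hb
    exact ⟨hsub, fun hh => (r2 z' (hh hz')).1 rfl⟩

theorem Conn3.conn_sdiff {S : Finset V} (hS : Conn3 G S) (x y : V) : Conn G (S \ {x, y}) := by
  intro T hT hne hc v hv
  simp only [Finset.mem_sdiff, Finset.mem_insert, Finset.mem_singleton] at hv
  have := hS (hT.trans Finset.sdiff_subset) hne x y (fun a ha b hb hab => by
    by_cases h : b = x ∨ b = y
    · tauto
    · exact Or.inl (hc a ha b (by simp [hb]; tauto) hab)) v hv.1
  tauto

/-- Each of three end-blocks left by deleting `x`, `y`, `z` from a 3-connected graph sees two of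
these vertices. -/
theorem Conn3.exists_adj_of_pend {S : Finset V} (hS : Conn3 G S) {x y z w : V}
    (hw : w = x ∨ w = y ∨ w = z) {T U W : Finset V} (hT : Pend G ((S \ {x, y}).erase z) T)
    (hU : Pend G ((S \ {x, y}).erase z) U) (hW : Pend G ((S \ {x, y}).erase z) W)
    (hTU : Sep G T U) (hTW : Sep G T W) (hUW : Sep G U W) :
    ∃ t ∈ T, ∃ v, (v = x ∨ v = y ∨ v = z) ∧ v ≠ w ∧ G.Adj v t := by
  obtain ⟨hT, hne, g, hg⟩ := hT
  obtain ⟨u, hu⟩ := hU.2.1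
  obtain ⟨u', hu'⟩ := hW.2.1
  have hm : ∀ v, v ∈ (S \ {x, y}).erase z ↔ v ≠ z ∧ v ∈ S ∧ v ≠ x ∧ v ≠ y := by
    intro v; simp
  by_contra! hn
  have := hS (fun t ht => ((hm t).1 (hT ht)).2.1) hne g w (by
    intro a ha b hb hab
    by_cases h' : b = x ∨ b = y ∨ b = z
    · by_contra! h''
      exact hn a ha b h' h''.2.2 hab.symm
    · push Not at h'
      have := hg a ha b ((hm b).2 ⟨h'.2.2, hb, h'.1, h'.2.1⟩) hab
      tauto)
  have a1 := (hm u).1 (hU.1 hu)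
  have a2 := (hm u').1 (hW.1 hu')
  have b1 := this u a1.2.1
  have b2 := this u' a2.2.1
  have c1 : u ∉ T := fun h' => (hTU u h' u hu).1 rfl
  have c2 : u' ∉ T := fun h' => (hTW u' h' u' hu').1 rfl
  have hug : u = g := by
    rcases b1 with h' | h' | rfl
    · exact absurd h' c1
    · exact h'
    · tauto
  have hug' : u' = g := by
    rcases b2 with h' | h' | rfl
    · exact absurd h' c2
    · exact h'
    · tauto
  exact (hUW u hu u' hu').1 (hug.trans hug'.symm)

theorem ClawFree.exists_not_adj (hG : ClawFree G) (v : V) {T U W : Finset V}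
    (hTU : Sep G T U) (hTW : Sep G T W) (hUW : Sep G U W) :
    (∀ t ∈ T, ¬ G.Adj v t) ∨ (∀ t ∈ U, ¬ G.Adj v t) ∨ (∀ t ∈ W, ¬ G.Adj v t) := by
  by_contra! hn
  obtain ⟨⟨a, ha, hva⟩, ⟨b, hb, hvb⟩, c, hc, hvc⟩ := hn
  have hab := hTU a ha b hb
  have hac := hTW a ha c hc
  have hbc := hUW b hb c hc
  rcases hG hva hvb hvc hab.1 hac.1 hbc.1 with h' | h' | h'
  · exact hab.2 h'
  · exact hac.2 h'
  · exact hbc.2 h'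

/-! ### End-blocks and extending an edge in the 3-connected case -/

/-- `P` is the interior of an end-block of `D`, attached at `e`, and `D` has other vertices. -/
structure EndBlock (G : SimpleGraph V) (D P : Finset V) (e : V) : Prop where
  subset : P ⊆ D
  nonempty : P.Nonempty
  mem : e ∈ D
  notMem : e ∉ P
  exit : ∀ a ∈ P, ∀ b ∈ D, G.Adj a b → b ∈ P ∨ b = e
  rest : ∃ r ∈ D, r ∉ P ∧ r ≠ e
  minimal : ∀ Q ⊂ P, ¬ Pend G D Q

namespace EndBlock

variable {D P : Finset V} {e : V}

/-- No subset of `P` that misses a vertex of `P` is pendant in `D`. -/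
theorem not_pend_erase (h : EndBlock G D P e) {z : V} (hz : z ∈ P) {Q : Finset V}
    (hQ : Q ⊆ P.erase z) : ¬ Pend G D Q := by
  refine h.minimal Q ⟨hQ.trans (Finset.erase_subset _ _), fun hn => ?_⟩
  exact absurd (hQ (hn hz)) (Finset.notMem_erase z P)

/-- A closed part of `D - z` avoiding `e` would lie inside `P` with `z` as its only exit, against
minimality of `P`. -/
theorem conn_erase (h : EndBlock G D P e) (hD : Conn G D) {z : V} (hz : z ∈ P) :
    Conn G (D.erase z) := by
  have hzD := h.subset hz
  have hez : e ≠ z := by rintro rfl; exact h.notMem hz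
  have main : ∀ Y ⊆ D.erase z, Y.Nonempty → e ∉ Y →
      (∀ a ∈ Y, ∀ b ∈ D.erase z, G.Adj a b → b ∈ Y) → False := by
    intro Y hY hne he hc
    have hYP : Y ⊆ P.erase z := by
      by_contra hn
      obtain ⟨v, hv, hvP⟩ := Finset.not_subset.1 hn
      have hvz := Finset.mem_erase.1 (hY hv)
      have hvP' : v ∉ P := fun h' => hvP (Finset.mem_erase.2 ⟨hvz.1, h'⟩)
      have := @hD (Y \ P) (Finset.sdiff_subset.trans (hY.trans (Finset.erase_subset _ _)))
        ⟨v, by simp [hv, hvP']⟩ (by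
        intro a ha b hb hab
        rw [Finset.mem_sdiff] at ha ⊢
        have hbP : b ∉ P := by
          intro hbP
          rcases h.exit b hbP a (Finset.mem_of_mem_erase (hY ha.1)) hab.symm with h1 | rfl
          · exact ha.2 h1
          · exact he ha.1
        refine ⟨hc a ha.1 b (Finset.mem_erase.2 ⟨?_, hb⟩) hab, hbP⟩
        rintro rfl
        exact hbP hz)
      exact (Finset.mem_sdiff.1 (this hzD)).2 hz
    refine h.not_pend_erase hz hYP ⟨hY.trans (Finset.erase_subset _ _), hne, z, ?_⟩
    intro a ha b hb hab
    by_cases hbz : b = z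
    · exact Or.inr hbz
    · exact Or.inl (hc a ha b (Finset.mem_erase.2 ⟨hbz, hb⟩) hab)
  intro T hT hne hc
  by_contra hn
  by_cases he : e ∈ T
  · refine main _ Finset.sdiff_subset (Finset.sdiff_nonempty.2 hn) (by simp [he]) ?_
    intro a ha b hb hab
    rw [Finset.mem_sdiff] at ha ⊢
    exact ⟨hb, fun hbT => ha.2 (hc b hbT a ha.1 hab.symm)⟩
  · exact main T hT hne he hc

theorem subset_or (h : EndBlock G D P e) {T : Finset V} (hT : Conn G T) (hTD : T ⊆ D)
    (he : e ∉ T) : T ⊆ P ∨ ∀ t ∈ T, t ∉ P := by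
  by_contra! hn
  obtain ⟨h1, t, ht, htP⟩ := hn
  obtain ⟨v, hv, hvP⟩ := Finset.not_subset.1 h1
  obtain ⟨a, ha, haP, b, hb, hbP, hab⟩ := hT.exists_exit ⟨t, htP, ht⟩ ⟨v, hv, hvP⟩
  rcases h.exit a haP b (hTD hb) hab with h' | rfl
  · exact hbP h'
  · exact he hb

theorem subset_erase (h : EndBlock G D P e) {z : V} (hz : z ∈ P) {T : Finset V} (hT : Conn G T)
    (hTD : T ⊆ D.erase z) (he : e ∉ T) (hzT : ∃ t ∈ T, G.Adj z t) : T ⊆ P.erase z := by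
  have hTD' := hTD.trans (Finset.erase_subset _ _)
  obtain ⟨t, ht, hzt⟩ := hzT
  have htP : t ∈ P := by
    rcases h.exit z hz t (hTD' ht) hzt with h' | rfl
    · exact h'
    · exact absurd ht he
  intro v hv
  refine Finset.mem_erase.2 ⟨(Finset.mem_erase.1 (hTD hv)).1, ?_⟩
  rcases h.subset_or hT hTD' he with h' | h'
  · exact h' hv
  · exact absurd htP (h' t ht)

/-- This places the end-blocks of a split inside `P`. Suppose `e ∈ T`. Then `U`, which sees `z`,
lies in `P`, while `W`, which does not, is pendant in `D` and so by minimality lies outside `P`.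
That puts the exit of `T` outside `P`, and `P - z` without `T` becomes a forbidden pendant set. -/
theorem notMem_of_pend (h : EndBlock G D P e) (hD : Conn G D) {z : V} (hz : z ∈ P)
    {T U W : Finset V} (hT : Pend G (D.erase z) T) (hU : Pend G (D.erase z) U)
    (hW : Pend G (D.erase z) W) (cU : Conn G U) (cW : Conn G W) (hTU : Sep G T U)
    (hTW : Sep G T W) (hzU : ∃ t ∈ U, G.Adj z t) (hzW : ∀ t ∈ W, ¬ G.Adj z t) : e ∉ T := by
  intro he
  obtain ⟨hTD, -, g, hg⟩ := hT
  have heU : e ∉ U := fun h' => (hTU e he e h').1 rfl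
  have heW : e ∉ W := fun h' => (hTW e he e h').1 rfl
  have hUP := h.subset_erase hz cU hU.1 heU hzU
  have hWD : W ⊆ D := hW.1.trans (Finset.erase_subset _ _)
  have hWP : ∀ t ∈ W, t ∉ P := by
    refine (h.subset_or cW hWD heW).resolve_left fun hWP => ?_
    obtain ⟨hWz, hne, k, hk⟩ := hW
    refine h.not_pend_erase hz (Q := W) (fun t ht => Finset.mem_erase.2
      ⟨(Finset.mem_erase.1 (hWz ht)).1, hWP ht⟩) ⟨hWD, hne, k, ?_⟩
    intro a ha b hb hab
    refine hk a ha b (Finset.mem_erase.2 ⟨?_, hb⟩) hab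
    rintro rfl
    exact hzW a ha hab.symm
  obtain ⟨w, hw⟩ := hW.2.1
  have hwT : w ∉ T := fun h' => (hTW w h' w hw).1 rfl
  have hgR : g ∉ P := by
    intro hgP
    -- otherwise everything outside `P` lies in `T`
    have := @hD (D \ (P ∪ T)) Finset.sdiff_subset ⟨w, by simp [hWD hw, hWP w hw, hwT]⟩ (by
      intro a ha b hb hab
      simp only [Finset.mem_sdiff, Finset.mem_union, not_or] at ha ⊢
      have hbP : b ∉ P := fun hbP => by
        rcases h.exit b hbP a ha.1 hab.symm with h' | rfl
        · exact ha.2.1 h'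
        · exact ha.2.2 he
      refine ⟨hb, hbP, fun hbT => ?_⟩
      have haz : a ≠ z := by rintro rfl; exact ha.2.1 hz
      rcases hg b hbT a (Finset.mem_erase.2 ⟨haz, ha.1⟩) hab.symm with h' | rfl
      · exact ha.2.2 h'
      · exact ha.2.1 hgP)
    have := this (h.subset hz)
    simp [hz] at this
  obtain ⟨u, hu⟩ := hU.2.1
  have huT : u ∉ T := fun h' => (hTU u h' u hu).1 rfl
  refine h.not_pend_erase hz (Q := P.erase z \ T) Finset.sdiff_subset
    ⟨fun v hv => h.subset (Finset.mem_of_mem_erase (Finset.mem_sdiff.1 hv).1),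
      ⟨u, Finset.mem_sdiff.2 ⟨hUP hu, huT⟩⟩, z, ?_⟩
  intro a ha b hb hab
  simp only [Finset.mem_sdiff, Finset.mem_erase] at ha ⊢
  have hbT : b ∉ T := by
    intro hbT
    rcases hg b hbT a (Finset.mem_erase.2 ⟨ha.1.1, h.subset ha.1.2⟩) hab.symm with h' | rfl
    · exact ha.2 h'
    · exact hgR ha.1.2
  rcases h.exit a ha.1.2 b hb hab with h' | rfl
  · tauto
  · exact absurd he hbT

end EndBlock

/-- Each set sees at least two of `x`, `y`, `z`, and each of these vertices misses at least one set.
Once `T₃` misses `z` and `T₁` misses `y`, both see `x`; so `T₂` misses `x`, and the whole pattern is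
determined. -/
theorem EndBlock.split_of_pend {S P : Finset V} {x y e z : V} (hS : Conn3 G S) (hG : ClawFree G)
    (h : EndBlock G (S \ {x, y}) P e) (hz : z ∈ P) {T₁ T₂ T₃ : Finset V}
    (h1 : Pend G ((S \ {x, y}).erase z) T₁) (h2 : Pend G ((S \ {x, y}).erase z) T₂)
    (h3 : Pend G ((S \ {x, y}).erase z) T₃) (c1 : Conn G T₁) (c2 : Conn G T₂) (c3 : Conn G T₃)
    (h12 : Sep G T₁ T₂) (h13 : Sep G T₁ T₃) (h23 : Sep G T₂ T₃) (z3 : ∀ t ∈ T₃, ¬ G.Adj z t)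
    (y1 : ∀ t ∈ T₁, ¬ G.Adj y t) : Split G (S \ {x, y}) P x y z T₁ T₂ := by
  have hD := hS.conn_sdiff x y
  obtain ⟨t₁, ht₁, v, hv, hvx, hvt⟩ :=
    hS.exists_adj_of_pend (w := z) (Or.inr (Or.inr rfl)) h1 h2 h3 h12 h13 h23
  have hx1 : G.Adj x t₁ := by
    rcases hv with rfl | rfl | rfl
    · exact hvt
    · exact absurd hvt (y1 t₁ ht₁)
    · exact absurd rfl hvx
  obtain ⟨s₁, hs₁, v, hv, hvx, hvt⟩ :=
    hS.exists_adj_of_pend (w := x) (Or.inl rfl) h1 h2 h3 h12 h13 h23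
  have hz1 : G.Adj z s₁ := by
    rcases hv with rfl | rfl | rfl
    · exact absurd rfl hvx
    · exact absurd hvt (y1 s₁ hs₁)
    · exact hvt
  obtain ⟨t₃, ht₃, v, hv, hvx, hvt⟩ :=
    hS.exists_adj_of_pend (w := y) (Or.inr (Or.inl rfl)) h3 h1 h2 h13.symm h23.symm h12
  have hx3 : G.Adj x t₃ := by
    rcases hv with rfl | rfl | rfl
    · exact hvt
    · exact absurd rfl hvx
    · exact absurd hvt (z3 t₃ ht₃)
  have x2 : ∀ t ∈ T₂, ¬ G.Adj x t := by
    rcases hG.exists_not_adj x h12 h13 h23 with h' | h' | h'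
    · exact absurd hx1 (h' t₁ ht₁)
    · exact h'
    · exact absurd hx3 (h' t₃ ht₃)
  obtain ⟨t₂, ht₂, v, hv, hvx, hvt⟩ :=
    hS.exists_adj_of_pend (w := z) (Or.inr (Or.inr rfl)) h2 h1 h3 h12.symm h23 h13
  have hy2 : G.Adj y t₂ := by
    rcases hv with rfl | rfl | rfl
    · exact absurd hvt (x2 t₂ ht₂)
    · exact hvt
    · exact absurd rfl hvx
  obtain ⟨s₂, hs₂, v, hv, hvx, hvt⟩ :=
    hS.exists_adj_of_pend (w := y) (Or.inr (Or.inl rfl)) h2 h1 h3 h12.symm h23 h13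
  have hz2 : G.Adj z s₂ := by
    rcases hv with rfl | rfl | rfl
    · exact absurd hvt (x2 s₂ hs₂)
    · exact absurd rfl hvx
    · exact hvt
  have e1 := h.notMem_of_pend hD hz h1 h2 h3 c2 c3 h12 h13 ⟨s₂, hs₂, hz2⟩ z3
  have e2 := h.notMem_of_pend hD hz h2 h1 h3 c1 c3 h12.symm h23 ⟨s₁, hs₁, hz1⟩ z3
  have ex : ∀ T, Pend G ((S \ {x, y}).erase z) T →
      ∃ g, ∀ a ∈ T, ∀ b ∈ S \ {x, y}, G.Adj a b → b ∈ T ∨ b = z ∨ b = g := by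
    rintro T ⟨-, -, g, hg⟩
    refine ⟨g, fun a ha b hb hab => ?_⟩
    by_cases hbz : b = z
    · exact Or.inr (Or.inl hbz)
    · exact (hg a ha b (Finset.mem_erase.2 ⟨hbz, hb⟩) hab).imp_right Or.inr
  exact ⟨h.subset_erase hz c1 h1.1 e1 ⟨s₁, hs₁, hz1⟩,
    h.subset_erase hz c2 h2.1 e2 ⟨s₂, hs₂, hz2⟩, c1, c2, h12, ex _ h1, ex _ h2,
    ⟨t₁, ht₁, hx1⟩, ⟨s₁, hs₁, hz1⟩, ⟨t₂, ht₂, hy2⟩, ⟨s₂, hs₂, hz2⟩, y1, x2⟩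

theorem EndBlock.exists_split {S P : Finset V} {x y e z : V} (hS : Conn3 G S) (hG : ClawFree G)
    (h : EndBlock G (S \ {x, y}) P e) (hz : z ∈ P)
    (hbad : ¬ Chain G ((S \ {x, y}).erase z)) :
    ∃ T₁ T₂, Split G (S \ {x, y}) P x y z T₁ T₂ := by
  have hD := hS.conn_sdiff x y
  by_contra hn
  have main := fun {T₁ T₂ T₃ : Finset V} h1 h2 h3 c1 c2 c3 h12 h13 h23 z3 y1 =>
    hn ⟨T₁, T₂, h.split_of_pend hS hG hz (T₃ := T₃) h1 h2 h3 c1 c2 c3 h12 h13 h23 z3 y1⟩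
  refine hbad (Chain.of_conn_pend (h.conn_erase hD hz) ?_)
  intro T₁ T₂ T₃ h1 h2 h3 c1 c2 c3 h12 h13 h23
  -- the end-block that does not see `z` sees `y`
  have hy : ∀ T U W, Pend G ((S \ {x, y}).erase z) T → Pend G ((S \ {x, y}).erase z) U →
      Pend G ((S \ {x, y}).erase z) W → Sep G T U → Sep G T W → Sep G U W →
      (∀ t ∈ T, ¬ G.Adj z t) → ¬ ∀ t ∈ T, ¬ G.Adj y t := by
    intro T U W hT hU hW hTU hTW hUW hz hy
    obtain ⟨t, ht, v, hv, hvx, hvt⟩ :=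
      hS.exists_adj_of_pend (w := x) (Or.inl rfl) hT hU hW hTU hTW hUW
    rcases hv with rfl | rfl | rfl
    · exact absurd rfl hvx
    · exact hy t ht hvt
    · exact hz t ht hvt
  have h21 := h12.symm
  have h31 := h13.symm
  have h32 := h23.symm
  rcases hG.exists_not_adj z h12 h13 h23 with z1 | z2 | z3
  · rcases hG.exists_not_adj y h12 h13 h23 with y1 | y2 | y3
    · exact hy _ _ _ h1 h2 h3 h12 h13 h23 z1 y1
    · exact (main h2 h3 h1 c2 c3 c1 h23 h21 h31 z1 y2)
    · exact (main h3 h2 h1 c3 c2 c1 h32 h31 h21 z1 y3)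
  · rcases hG.exists_not_adj y h12 h13 h23 with y1 | y2 | y3
    · exact (main h1 h3 h2 c1 c3 c2 h13 h12 h32 z2 y1)
    · exact hy _ _ _ h2 h1 h3 h21 h23 h13 z2 y2
    · exact (main h3 h1 h2 c3 c1 c2 h31 h32 h12 z2 y3)
  · rcases hG.exists_not_adj y h12 h13 h23 with y1 | y2 | y3
    · exact (main h1 h2 h3 c1 c2 c3 h12 h13 h23 z3 y1)
    · exact (main h2 h1 h3 c2 c1 c3 h21 h23 h13 z3 y2)
    · exact hy _ _ _ h3 h1 h2 h31 h32 h12 z3 y3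

/-- An end-block interior contains a neighbour of `y` that can be deleted along with `x`, `y`. -/
theorem EndBlock.exists_chain {S P : Finset V} {x y e : V} (hS : Conn3 G S) (hG : ClawFree G)
    (hx : x ∈ S) (hy : y ∈ S) (h : EndBlock G (S \ {x, y}) P e) :
    ∃ z ∈ P, G.Adj y z ∧ Chain G ((S \ {x, y}).erase z) := by
  have hD := hS.conn_sdiff x y
  have hm : ∀ v, v ∈ S \ {x, y} ↔ v ∈ S ∧ v ≠ x ∧ v ≠ y := by intro v; simp
  obtain ⟨r, hrD, hrP, hre⟩ := h.rest
  have hex := (hm e).1 h.mem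
  -- both sides of the cut vertex `e` see any of `x` and `y`
  have see : ∀ T ⊆ S \ {x, y}, T.Nonempty →
      (∀ a ∈ T, ∀ b ∈ S \ {x, y}, G.Adj a b → b ∈ T ∨ b = e) → ∀ v w, v ∈ S → v ≠ w → v ≠ e →
      v ∉ S \ {x, y} → (∀ u, u = x ∨ u = y → u = v ∨ u = w) → ∃ t ∈ T, G.Adj v t := by
    intro T hT hne hc v w hvS hvw hve hvD hvw'
    by_contra! hn
    have := hS (fun t ht => ((hm t).1 (hT ht)).1) hne e w (by
      intro a ha b hb hab
      by_cases hbD : b ∈ S \ {x, y}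
      · have := hc a ha b hbD hab
        tauto
      · have hb' := hvw' b (by rw [hm] at hbD; tauto)
        rcases hb' with rfl | rfl
        · exact absurd hab.symm (hn a ha)
        · tauto) v hvS
    rcases this with h' | h' | h'
    · exact hvD (hT h')
    · exact hve h'
    · exact hvw h'
  have hR : ∀ a ∈ (S \ {x, y}) \ insert e P, ∀ b ∈ S \ {x, y}, G.Adj a b →
      b ∈ (S \ {x, y}) \ insert e P ∨ b = e := by
    intro a ha b hb hab
    rw [Finset.mem_sdiff, Finset.mem_insert, not_or] at ha ⊢
    by_contra hn
    rw [not_or] at hn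
    have hbP : b ∈ P := by
      by_contra hbP
      exact hn.1 ⟨hb, ⟨hn.2, hbP⟩⟩
    rcases h.exit b hbP a ha.1 hab.symm with h' | h'
    · exact ha.2.2 h'
    · exact ha.2.1 h'
  have hRne : ((S \ {x, y}) \ insert e P).Nonempty :=
    ⟨r, by rw [Finset.mem_sdiff, Finset.mem_insert]; tauto⟩
  -- If `x = y`, then `x` and `e` would separate `P` from `r`.
  by_cases hxy : x = y
  · exfalso
    subst hxy
    have := hS (fun t ht => ((hm t).1 (h.subset ht)).1) h.nonempty e x (by
      intro a ha b hb hab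
      by_cases hbx : b = x
      · tauto
      · have := h.exit a ha b ((hm b).2 ⟨hb, hbx, hbx⟩) hab
        tauto) r ((hm r).1 hrD).1
    have := (hm r).1 hrD
    tauto
  -- The neighbour of `x` beyond `e` makes the neighbours of `x` inside `P` a clique, as the descent
  -- requires.
  obtain ⟨rx, hrx, hxrx⟩ := see _ Finset.sdiff_subset hRne hR x y hx hxy hex.2.1.symm
    (by simp) (by tauto)
  obtain ⟨z₀, hz₀, hyz₀⟩ := see P h.subset h.nonempty h.exit y x hy (Ne.symm hxy) hex.2.2.symm
    (by simp) (by tauto)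
  have hxcl : ∀ a ∈ P, ∀ b ∈ P, G.Adj x a → G.Adj x b → a ≠ b → G.Adj a b := by
    intro a ha b hb hxa hxb hab
    rw [Finset.mem_sdiff, Finset.mem_insert, not_or] at hrx
    have hrn : ∀ c ∈ P, c ≠ rx ∧ ¬ G.Adj c rx := by
      intro c hc
      refine ⟨by rintro rfl; exact hrx.2.2 hc, fun hcr => ?_⟩
      have := h.exit c hc rx hrx.1 hcr
      tauto
    rcases hG hxa hxb hxrx hab (hrn a ha).1 (hrn b hb).1 with h' | h' | h'
    · exact h'
    · exact absurd h' (hrn a ha).2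
    · exact absurd h' (hrn b hb).2
  by_contra! hbad
  have hPne : P ≠ S \ {x, y} := by
    intro h'
    rw [h'] at hrP
    exact hrP hrD
  -- Infinite descent on the order of `T₂`: it contains a neighbour of `y`, whose own split has a
  -- strictly smaller second part.
  have desc : ∀ n, ∀ z T₁ T₂, G.Adj y z → Split G (S \ {x, y}) P x y z T₁ T₂ →
      T₂.card = n → False := by
    intro n
    induction n using Nat.strong_induction_on with
    | _ n ih =>
      intro z T₁ T₂ hyz hsp hn
      obtain ⟨z', hz', hyz'⟩ := hsp.y₂
      have hz'P := Finset.mem_of_mem_erase (hsp.subset₂ hz')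
      obtain ⟨U₁, U₂, hU⟩ := h.exists_split hS hG hz'P (hbad z' hz'P hyz')
      have := hsp.exists_smaller hD h.subset hPne hxcl hyz hz' hU
      exact ih _ (hn ▸ Finset.card_lt_card this) z' U₁ U₂ hyz' hU rfl
  obtain ⟨U₁, U₂, hU⟩ := h.exists_split hS hG hz₀ (hbad z₀ hz₀ hyz₀)
  exact desc _ z₀ U₁ U₂ hyz₀ hU rfl

theorem Pend.exists_endBlock {D T : Finset V} (hD : Conn G D) (hT : Pend G D T)
    {u w : V} (hu : u ∈ D) (hw : w ∈ D) (huw : u ≠ w) (huT : u ∉ T) (hwT : w ∉ T) :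
    ∃ P ⊆ T, ∃ e, EndBlock G D P e := by
  induction T using Finset.strongInduction with
  | H T ih =>
    by_cases hmin : ∃ Q ⊂ T, Pend G D Q
    · obtain ⟨Q, hQT, hQ⟩ := hmin
      obtain ⟨P, hP, h'⟩ := ih Q hQT hQ (fun h' => huT (hQT.1 h')) (fun h' => hwT (hQT.1 h'))
      exact ⟨P, hP.trans hQT.1, h'⟩
    · push Not at hmin
      obtain ⟨hTD, hne, e, he⟩ := hT
      have heD : e ∈ D ∧ e ∉ T := by
        by_contra hn
        refine huT (hD hTD hne (fun a ha b hb hab => ?_) hu)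
        rcases he a ha b hb hab with h' | rfl
        · exact h'
        · by_contra h''
          exact hn ⟨hb, h''⟩
      refine ⟨T, subset_rfl, e, hTD, hne, heD.1, heD.2, he, ?_, hmin⟩
      by_cases hue : u = e
      · exact ⟨w, hw, hwT, fun hwe => huw (hue.trans hwe.symm)⟩
      · exact ⟨u, hu, huT, hue⟩

/-- In a 3-connected claw-free graph every edge `xy` extends in two ways to a path centred at `y`
whose deletion leaves a connected graph with at most two end-blocks. -/
theorem Conn3.exists_two_chain {S : Finset V} (hS : Conn3 G S) (hG : ClawFree G)
    (hcard : 3 < S.card) {x y : V} (hx : x ∈ S) (hy : y ∈ S) :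
    ∃ z₁ z₂, z₁ ≠ z₂ ∧ ∀ z, z = z₁ ∨ z = z₂ →
      z ∈ S \ {x, y} ∧ G.Adj y z ∧ Chain G ((S \ {x, y}).erase z) := by
  have hm : ∀ v, v ∈ S \ {x, y} ↔ v ∈ S ∧ v ≠ x ∧ v ≠ y := by intro v; simp
  have hD := hS.conn_sdiff x y
  by_cases h2 : Conn2 G (S \ {x, y})
  -- Without a cut vertex every choice works, so two neighbours of `y` other than `x` suffice;
  -- otherwise `x` and `w` would cut off `y`.
  · have one : ∀ w, ∃ z ∈ S, z ≠ x ∧ z ≠ w ∧ G.Adj y z := by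
      intro w
      by_contra! hn
      have := @hS {y} (by simpa) (by simp) x w (by
        intro a ha b hb hab
        rw [Finset.mem_singleton] at ha
        subst ha
        by_contra! h'
        exact hn b hb h'.2.1 h'.2.2 hab)
      have hsub : S ⊆ {y, x, w} := fun v hv => by
        have := this v hv
        simp only [Finset.mem_insert, Finset.mem_singleton] at this ⊢
        tauto
      have := Finset.card_le_card hsub
      have := Finset.card_le_three (a := y) (b := x) (c := w)
      omega
    obtain ⟨z₁, hz₁, hx₁, -, hy₁⟩ := one x
    obtain ⟨z₂, hz₂, hx₂, h12, hy₂⟩ := one z₁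
    refine ⟨z₁, z₂, h12.symm, ?_⟩
    rintro z (rfl | rfl)
    · exact ⟨(hm z).2 ⟨hz₁, hx₁, hy₁.ne'⟩, hy₁, h2.chain_erase hG z⟩
    · exact ⟨(hm z).2 ⟨hz₂, hx₂, hy₂.ne'⟩, hy₂, h2.chain_erase hG z⟩
  · obtain ⟨c, A, B, hc⟩ := hD.exists_cut h2
    -- Each side of the cut contains an end-block interior, so the two choices are distinct.
    have side : ∀ A B, Cut G (S \ {x, y}) c A B →
        ∃ z ∈ A, G.Adj y z ∧ Chain G ((S \ {x, y}).erase z) := by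
      intro A B hc
      have hmc := hc.mem_iff
      obtain ⟨b, hb⟩ := hc.nonempty_right
      have hA : Pend G (S \ {x, y}) A := by
        refine ⟨fun v hv => (hmc v).2 (by tauto), hc.nonempty_left, c, fun a ha v hv hav => ?_⟩
        rcases (hmc v).1 hv with h' | h' | h'
        · tauto
        · tauto
        · exact absurd hav (hc.sep a ha v h').2
      obtain ⟨P, hP, e, hE⟩ := hA.exists_endBlock hD (u := b) (w := c) ((hmc b).2 (by tauto))
        ((hmc c).2 (by tauto)) (by rintro rfl; exact hc.notMem_right hb)
        (fun h' => (hc.sep b h' b hb).1 rfl) hc.notMem_left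
      obtain ⟨z, hz, h'⟩ := hE.exists_chain hS hG hx hy
      exact ⟨z, hP hz, h'⟩
    obtain ⟨z₁, hz₁, h1⟩ := side A B hc
    obtain ⟨z₂, hz₂, h2⟩ := side B A hc.symm
    have hmc := hc.mem_iff
    refine ⟨z₁, z₂, (hc.sep z₁ hz₁ z₂ hz₂).1, ?_⟩
    rintro z (rfl | rfl)
    · exact ⟨(hmc z).2 (by tauto), h1⟩
    · exact ⟨(hmc z).2 (by tauto), h2⟩

/-! ### Two leaves and a maximal leg -/

/-- `S` has leaves `l₁`, `l₂` attached at `c₁`, `c₂`, meeting every pendant set; `a₁` is a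
neighbour of `c₁` that is no cut vertex; every cut of `S` has a side with only one vertex. -/
structure TwoLeaves (G : SimpleGraph V) (S : Finset V) (l₁ c₁ a₁ l₂ c₂ : V) : Prop where
  conn : Conn G S
  l₁_mem : l₁ ∈ S
  c₁_mem : c₁ ∈ S
  a₁_mem : a₁ ∈ S
  l₂_mem : l₂ ∈ S
  c₂_mem : c₂ ∈ S
  l₁c₁ : G.Adj l₁ c₁
  l₂c₂ : G.Adj l₂ c₂
  c₁a₁ : G.Adj c₁ a₁
  leaf₁ : ∀ b ∈ S, G.Adj l₁ b → b = c₁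
  leaf₂ : ∀ b ∈ S, G.Adj l₂ b → b = c₂
  a₁_ne_l₁ : a₁ ≠ l₁
  l₁_ne_l₂ : l₁ ≠ l₂
  c₁_ne_l₂ : c₁ ≠ l₂
  a₁_ne_l₂ : a₁ ≠ l₂
  a₁_ne_c₂ : a₁ ≠ c₂
  not_cut : ∀ T ⊆ S, T.Nonempty → (∀ a ∈ T, ∀ b ∈ S, G.Adj a b → b ∈ T ∨ b = a₁) →
    ∀ v ∈ S, v ∈ T ∨ v = a₁
  meets : ∀ U, Pend G S U → l₁ ∈ U ∨ c₁ ∈ U ∨ l₂ ∈ U ∨ c₂ ∈ U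
  cut : ∀ c A B, Cut G S c A B → A.card = 1 ∨ B.card = 1

/-- `X` is attached to the rest of `S` at `a₁` and `f` only, away from the two leaves. -/
structure Leg (G : SimpleGraph V) (S : Finset V) (c₁ a₁ l₂ c₂ : V) (X : Finset V) (f : V) :
    Prop where
  subset : X ⊆ S
  c₁_notMem : c₁ ∉ X
  a₁_notMem : a₁ ∉ X
  not_adj : ∀ t ∈ X, ¬ G.Adj c₁ t
  l₂_notMem : l₂ ∉ X
  c₂_notMem : c₂ ∉ X
  exists_adj : ∃ u ∈ X, G.Adj a₁ u
  exit : ∀ a ∈ X, ∀ b ∈ S, G.Adj a b → b ∈ X ∨ b = a₁ ∨ b = f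

/-- A leg together with the facts on its attachment `f` that follow from maximality. -/
structure MaxLeg (G : SimpleGraph V) (S : Finset V) (l₁ c₁ a₁ l₂ c₂ : V) (L : Finset V)
    (f : V) : Prop extends Leg G S c₁ a₁ l₂ c₂ L f where
  max : ∀ X f', Leg G S c₁ a₁ l₂ c₂ X f' → X.card ≤ L.card
  l₁_notMem : l₁ ∉ L
  f_mem : f ∈ S
  f_notMem : f ∉ L
  f_ne_l₁ : f ≠ l₁
  f_ne_c₁ : f ≠ c₁
  f_ne_a₁ : f ≠ a₁
  f_ne_l₂ : f ≠ l₂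
  f_ne_c₂ : f ≠ c₂
  exists_adj_f : ∃ w ∈ L, G.Adj f w
  exists_out : ∃ o ∈ S, o ∉ L ∧ o ≠ a₁ ∧ G.Adj f o

section

variable {S L : Finset V} {l₁ c₁ a₁ l₂ c₂ f : V}

/-- Since `a₁` is no cut vertex, `f` must be a genuine second attachment, with neighbours on both
sides. -/
theorem Leg.maxLeg (hG : ClawFree G) (h : TwoLeaves G S l₁ c₁ a₁ l₂ c₂)
    (hL : Leg G S c₁ a₁ l₂ c₂ L f) (hmax : ∀ X f', Leg G S c₁ a₁ l₂ c₂ X f' → X.card ≤ L.card) :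
    MaxLeg G S l₁ c₁ a₁ l₂ c₂ L f := by
  obtain ⟨u, hu, hau⟩ := hL.exists_adj
  have hl₁ : l₁ ∉ L := fun h' => hL.not_adj l₁ h' h.l₁c₁.symm
  have hex : f ∈ S ∧ f ∉ L ∧ f ≠ a₁ ∧ ∃ w ∈ L, G.Adj f w := by
    by_contra hn
    have := h.not_cut L hL.subset ⟨u, hu⟩ (by
      intro a ha b hb hab
      rcases hL.exit a ha b hb hab with h' | h' | rfl
      · exact Or.inl h'
      · exact Or.inr h'
      · by_contra h''
        rw [not_or] at h''
        exact hn ⟨hb, h''.1, h''.2, a, ha, hab.symm⟩) c₁ h.c₁_mem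
    exact this.elim hL.c₁_notMem h.c₁a₁.ne
  obtain ⟨hfS, hfL, hfa, w, hw, hfw⟩ := hex
  have hfl₁ : f ≠ l₁ := by
    rintro rfl
    have := h.leaf₁ w (hL.subset hw) hfw
    exact hL.c₁_notMem (this ▸ hw)
  have hfc₁ : f ≠ c₁ := by
    rintro rfl
    exact hL.not_adj w hw hfw
  have hfl₂ : f ≠ l₂ := by
    rintro rfl
    have := h.leaf₂ w (hL.subset hw) hfw
    exact hL.c₂_notMem (this ▸ hw)
  have hout : ∃ o ∈ S, o ∉ L ∧ o ≠ a₁ ∧ G.Adj f o := by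
    by_contra! hn
    have := h.not_cut (insert f L) (Finset.insert_subset hfS hL.subset) ⟨f, by simp⟩ (by
      intro a ha b hb hab
      rw [Finset.mem_insert] at ha ⊢
      rcases ha with rfl | ha
      · by_cases hbL : b ∈ L
        · tauto
        · by_contra h'
          exact hn b hb hbL (fun hba => h' (Or.inr hba)) hab
      · have := hL.exit a ha b hb hab
        tauto) c₁ h.c₁_mem
    rw [Finset.mem_insert] at this
    rcases this with (h' | h') | h'
    · exact hfc₁ h'.symm
    · exact hL.c₁_notMem h'
    · exact h.c₁a₁.ne h'
  refine ⟨hL, hmax, hl₁, hfS, hfL, hfl₁, hfc₁, hfa, hfl₂, ?_, ⟨w, hw, hfw⟩, hout⟩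
  -- If `f` were `c₂`, claw-freeness would confine its neighbours to the leg, `l₂` and `a₁`, and
  -- `a₁` would cut off the leg with both.
  rintro rfl
  have hwl : ¬ G.Adj l₂ w := fun h' => h.l₂c₂.ne' (by
    have := h.leaf₂ w (hL.subset hw) h'
    exact absurd (this ▸ hw) hfL)
  have hnb : ∀ v ∈ S, G.Adj f v → v ∈ L ∨ v = l₂ ∨ v = a₁ := by
    intro v hv hfv
    by_contra hn
    simp only [not_or] at hn
    rcases hG hfv hfw h.l₂c₂.symm (by rintro rfl; exact hn.1 hw) hn.2.1
      (by rintro rfl; exact hL.l₂_notMem hw) with h' | h' | h'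
    · rcases hL.exit w hw v hv h'.symm with h'' | h'' | h''
      · exact hn.1 h''
      · exact hn.2.2 h''
      · exact hfv.ne h''.symm
    · exact hfv.ne (h.leaf₂ v hv h'.symm).symm
    · exact hwl h'.symm
  have := h.not_cut (insert f (insert l₂ L)) (by
      intro v hv
      simp only [Finset.mem_insert] at hv
      rcases hv with rfl | rfl | hv
      exacts [hfS, h.l₂_mem, hL.subset hv]) ⟨f, by simp⟩ (by
    intro a ha b hb hab
    simp only [Finset.mem_insert] at ha ⊢
    rcases ha with rfl | rfl | ha
    · have := hnb b hb hab
      tauto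
    · have := h.leaf₂ b hb hab
      tauto
    · have := hL.exit a ha b hb hab
      tauto) c₁ h.c₁_mem
  simp only [Finset.mem_insert] at this
  rcases this with (h' | h' | h') | h'
  · exact hfc₁ h'.symm
  · exact h.c₁_ne_l₂ h'
  · exact hL.c₁_notMem h'
  · exact h.c₁a₁.ne h'

namespace MaxLeg

/-- The neighbours of `a₁` outside the leg. -/
theorem adj_a₁ (hL : MaxLeg G S l₁ c₁ a₁ l₂ c₂ L f) (hG : ClawFree G)
    (h : TwoLeaves G S l₁ c₁ a₁ l₂ c₂) {v : V} (hv : v ∈ S) (hav : G.Adj a₁ v) :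
    v ∈ L ∨ v = f ∨ v = c₁ ∨ G.Adj c₁ v := by
  by_contra hn
  simp only [not_or] at hn
  obtain ⟨u, hu, hau⟩ := hL.exists_adj
  rcases hG hav hau h.c₁a₁.symm (by rintro rfl; exact hn.1 hu) hn.2.2.1
    (by rintro rfl; exact hL.c₁_notMem hu) with h' | h' | h'
  · rcases hL.exit u hu v hv h'.symm with h'' | h'' | h''
    · exact hn.1 h''
    · exact hav.ne h''.symm
    · exact hn.2.1 h''
  · exact hn.2.2.2 h'.symm
  · exact hL.not_adj u hu h'.symm

theorem not_pend (hL : MaxLeg G S l₁ c₁ a₁ l₂ c₂ L f) (h : TwoLeaves G S l₁ c₁ a₁ l₂ c₂)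
    {T : Finset V} (hT : T ⊆ insert f (insert a₁ L)) : ¬ Pend G S T := by
  intro hp
  have hm : ∀ v, v ∈ insert f (insert a₁ L) ↔ v = f ∨ v = a₁ ∨ v ∈ L := by simp
  rcases h.meets T hp with h' | h' | h' | h' <;> rcases (hm _).1 (hT h') with h' | h' | h'
  exacts [hL.f_ne_l₁ h'.symm, h.a₁_ne_l₁ h'.symm, hL.l₁_notMem h', hL.f_ne_c₁ h'.symm,
    h.c₁a₁.ne h', hL.c₁_notMem h', hL.f_ne_l₂ h'.symm, h.a₁_ne_l₂ h'.symm, hL.l₂_notMem h',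
    hL.f_ne_c₂ h'.symm, h.a₁_ne_c₂ h'.symm, hL.c₂_notMem h']

theorem adj_of_adj_a₁ (hL : MaxLeg G S l₁ c₁ a₁ l₂ c₂ L f) (hG : ClawFree G)
    (h : TwoLeaves G S l₁ c₁ a₁ l₂ c₂) {v w : V} (hv : v ∈ L) (hw : w ∈ L) (hav : G.Adj a₁ v)
    (haw : G.Adj a₁ w) (hvw : v ≠ w) : G.Adj v w := by
  rcases hG hav haw h.c₁a₁.symm hvw (by rintro rfl; exact hL.c₁_notMem hv)
    (by rintro rfl; exact hL.c₁_notMem hw) with h' | h' | h'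
  · exact h'
  · exact absurd h'.symm (hL.not_adj v hv)
  · exact absurd h'.symm (hL.not_adj w hw)

theorem adj_of_adj_f (hL : MaxLeg G S l₁ c₁ a₁ l₂ c₂ L f) (hG : ClawFree G)
    {v w : V} (hv : v ∈ L) (hw : w ∈ L) (hav : G.Adj f v)
    (haw : G.Adj f w) (hvw : v ≠ w) : G.Adj v w := by
  obtain ⟨o, ho, hoL, hoa, hfo⟩ := hL.exists_out
  have key : ∀ t ∈ L, ¬ G.Adj t o := fun t ht h' => by
    rcases hL.exit t ht o ho h' with h'' | h'' | h''
    · exact hoL h''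
    · exact hoa h''
    · exact hfo.ne h''.symm
  rcases hG hav haw hfo hvw (by rintro rfl; exact hoL hv)
    (by rintro rfl; exact hoL hw) with h' | h' | h'
  · exact h'
  · exact absurd h' (key v hv)
  · exact absurd h' (key w hw)

/-- The neighbours of `f` outside the leg and `a₁` form a clique. -/
theorem adj_of_adj_out (hL : MaxLeg G S l₁ c₁ a₁ l₂ c₂ L f) (hG : ClawFree G)
    {v w : V} (hvS : v ∈ S) (hwS : w ∈ S) (hv : v ∉ L) (hw : w ∉ L) (hva : v ≠ a₁) (hwa : w ≠ a₁)
    (hfv : G.Adj f v) (hfw : G.Adj f w) (hvw : v ≠ w) : G.Adj v w := by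
  obtain ⟨t, ht, hft⟩ := hL.exists_adj_f
  have key : ∀ o ∈ S, o ∉ L → o ≠ a₁ → G.Adj f o → ¬ G.Adj o t := fun o ho hoL hoa hfo h' => by
    rcases hL.exit t ht o ho h'.symm with h'' | h'' | h''
    · exact hoL h''
    · exact hoa h''
    · exact hfo.ne h''.symm
  rcases hG hfv hfw hft hvw (by rintro rfl; exact hv ht)
    (by rintro rfl; exact hw ht) with h' | h' | h'
  · exact h'
  · exact absurd h' (key v hvS hv hva hfv)
  · exact absurd h' (key w hwS hw hwa hfw)

theorem sees (hL : MaxLeg G S l₁ c₁ a₁ l₂ c₂ L f) (h : TwoLeaves G S l₁ c₁ a₁ l₂ c₂)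
    {X T : Finset V} (hLX : L ⊆ X) (hXL : X ⊆ insert f (insert a₁ L)) (hT : Pend G X T) :
    (a₁ ∈ X ∧ a₁ ∈ T ∨ a₁ ∉ X ∧ ∃ t ∈ T, t ∈ L ∧ G.Adj a₁ t) ∨
      (f ∈ X ∧ f ∈ T ∨ f ∉ X ∧ ∃ t ∈ T, t ∈ L ∧ G.Adj f t) := by
  obtain ⟨hTX, hne, g, hg⟩ := hT
  by_contra hn
  simp only [not_or, not_and, not_exists] at hn
  have hTL : T ⊆ L := by
    intro t ht
    have := hXL (hTX ht)
    simp only [Finset.mem_insert] at this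
    rcases this with rfl | rfl | h'
    · exact absurd ht (hn.2.1 (hTX ht))
    · exact absurd ht (hn.1.1 (hTX ht))
    · exact h'
  refine hL.not_pend h (hTX.trans hXL) ⟨hTL.trans hL.subset, hne, g, fun a ha b hb hab => ?_⟩
  by_cases hbX : b ∈ X
  · exact hg a ha b hbX hab
  · rcases hL.exit a (hTL ha) b hb hab with h' | rfl | rfl
    · exact absurd (hLX h') hbX
    · exact absurd hab.symm (hn.1.2 hbX a ha (hTL ha))
    · exact absurd hab.symm (hn.2.2 hbX a ha (hTL ha))

/-- Here `X` is the leg, the leg with `f`, or the leg with both attachments. No pendant set of `S`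
lies inside `X`, so every pendant set of `X` touches the `a₁` end or the `f` end, and each end is a
vertex of `X` or a clique of neighbours in `L`. -/
theorem chain_of_subset (hL : MaxLeg G S l₁ c₁ a₁ l₂ c₂ L f) (hG : ClawFree G)
    (h : TwoLeaves G S l₁ c₁ a₁ l₂ c₂) {X : Finset V} (hLX : L ⊆ X)
    (hXL : X ⊆ insert f (insert a₁ L)) (hfa : a₁ ∈ X → f ∈ X) : Chain G X := by
  have hXS : X ⊆ S := fun v hv => by
    have := hXL hv
    simp only [Finset.mem_insert] at this
    rcases this with rfl | rfl | h'
    exacts [hL.f_mem, h.a₁_mem, hL.subset h']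
  refine ⟨fun T hT hne hc => ?_, fun T₁ T₂ T₃ h1 h2 h3 h12 h13 h23 => ?_⟩
  · by_contra hn
    have hc' : ∀ a ∈ X \ T, ∀ b ∈ X, G.Adj a b → b ∈ X \ T := by
      intro a ha b hb hab
      rw [Finset.mem_sdiff] at ha ⊢
      exact ⟨hb, fun hbT => ha.2 (hc b hbT a ha.1 hab.symm)⟩
    have hne' := Finset.sdiff_nonempty.2 hn
    by_cases hfX : f ∈ X
    · have side : ∀ Y ⊆ X, Y.Nonempty → (∀ a ∈ Y, ∀ b ∈ X, G.Adj a b → b ∈ Y) → f ∈ Y := by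
        intro Y hY hYne hYc
        by_contra hfY
        have hne : (Y ∩ L).Nonempty := by
          obtain ⟨y, hy⟩ := hYne
          have := hXL (hY hy)
          simp only [Finset.mem_insert] at this
          rcases this with rfl | rfl | h'
          · exact absurd hy hfY
          · obtain ⟨u, hu, hau⟩ := hL.exists_adj
            exact ⟨u, Finset.mem_inter.2 ⟨hYc _ hy u (hLX hu) hau, hu⟩⟩
          · exact ⟨y, Finset.mem_inter.2 ⟨hy, h'⟩⟩
        refine hL.not_pend h (Finset.inter_subset_right.trans (hLX.trans hXL))
          ⟨Finset.inter_subset_right.trans hL.subset, hne, a₁, fun a ha b hb hab => ?_⟩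
        rw [Finset.mem_inter] at ha ⊢
        rcases hL.exit a ha.2 b hb hab with h' | h' | rfl
        · exact Or.inl ⟨hYc a ha.1 b (hLX h') hab, h'⟩
        · exact Or.inr h'
        · exact absurd (hYc a ha.1 b hfX hab) hfY
      exact (Finset.mem_sdiff.1 (side _ Finset.sdiff_subset hne' hc')).2 (side T hT hne hc)
    · have hXL' : X ⊆ L := by
        intro v hv
        have := hXL hv
        simp only [Finset.mem_insert] at this
        rcases this with rfl | rfl | h'
        exacts [absurd hv hfX, absurd (hfa hv) hfX, h']
      have side : ∀ Y ⊆ X, Y.Nonempty → (∀ a ∈ Y, ∀ b ∈ X, G.Adj a b → b ∈ Y) →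
          ∃ y ∈ Y, G.Adj a₁ y := by
        intro Y hY hYne hYc
        by_contra! hn
        refine hL.not_pend h (hY.trans hXL) ⟨hY.trans hXS, hYne, f, fun a ha b hb hab => ?_⟩
        rcases hL.exit a (hXL' (hY ha)) b hb hab with h' | rfl | rfl
        · exact Or.inl (hYc a ha b (hLX h') hab)
        · exact absurd hab.symm (hn a ha)
        · exact Or.inr rfl
      obtain ⟨t, ht, hat⟩ := side T hT hne hc
      obtain ⟨u, hu, hau⟩ := side _ Finset.sdiff_subset hne' hc'
      rw [Finset.mem_sdiff] at hu
      have htu : t ≠ u := by rintro rfl; exact hu.2 ht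
      exact hu.2 (hc t ht u hu.1
        (hL.adj_of_adj_a₁ hG h (hXL' (hT ht)) (hXL' hu.1) hat hau htu))
  · refine false_of_three_of_two
      (P := fun T => a₁ ∈ X ∧ a₁ ∈ T ∨ a₁ ∉ X ∧ ∃ t ∈ T, t ∈ L ∧ G.Adj a₁ t)
      (Q := fun T => f ∈ X ∧ f ∈ T ∨ f ∉ X ∧ ∃ t ∈ T, t ∈ L ∧ G.Adj f t)
      (hL.sees h hLX hXL h1) (hL.sees h hLX hXL h2)
      (hL.sees h hLX hXL h3) ?_ ?_ h12 h13 h23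
    · rintro T U hTU (⟨hX, hT⟩ | ⟨hX, t, ht, htL, hat⟩) (⟨hX', hU⟩ | ⟨hX', u, hu, huL, hau⟩)
      · exact (hTU _ hT _ hU).1 rfl
      · exact hX' hX
      · exact hX hX'
      · have := hTU t ht u hu
        exact this.2 (hL.adj_of_adj_a₁ hG h htL huL hat hau this.1)
    · rintro T U hTU (⟨hX, hT⟩ | ⟨hX, t, ht, htL, hat⟩) (⟨hX', hU⟩ | ⟨hX', u, hu, huL, hau⟩)
      · exact (hTU _ hT _ hU).1 rfl
      · exact hX' hX
      · exact hX hX'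
      · have := hTU t ht u hu
        exact this.2 (hL.adj_of_adj_f hG htL huL hat hau this.1)

/-- Deleting the leg and possibly its attachments keeps the remainder connected. -/
theorem conn_of_compl (hL : MaxLeg G S l₁ c₁ a₁ l₂ c₂ L f) (hG : ClawFree G)
    (h : TwoLeaves G S l₁ c₁ a₁ l₂ c₂) {W : Finset V} (hWS : W ⊆ S) (hWL : ∀ v ∈ W, v ∉ L)
    (hW : ∀ v ∈ S, v ∉ L → v ≠ f → v ≠ a₁ → v ∈ W) (hfa : f ∈ W → a₁ ∈ W) : Conn G W := by
  have hl₁W := hW _ h.l₁_mem hL.l₁_notMem hL.f_ne_l₁.symm h.a₁_ne_l₁.symm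
  have hc₁W := hW _ h.c₁_mem hL.c₁_notMem hL.f_ne_c₁.symm h.c₁a₁.ne
  have hl₂W := hW _ h.l₂_mem hL.l₂_notMem hL.f_ne_l₂.symm h.a₁_ne_l₂.symm
  have hc₂W := hW _ h.c₂_mem hL.c₂_notMem hL.f_ne_c₂.symm h.a₁_ne_c₂.symm
  -- A part `Y` avoiding `c₁` communicates with the rest of `S` through `f` only. If `f ∈ Y`, then
  -- `a₁` cuts off `Y` with the leg. If not, `Y` is pendant and contains `l₂` and `c₂`, while `l₁`
  -- and `c₁` lie across the cut at `f`: neither side is a single vertex.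
  have main : ∀ Y ⊆ W, Y.Nonempty → (∀ a ∈ Y, ∀ b ∈ W, G.Adj a b → b ∈ Y) → c₁ ∉ Y → False := by
    intro Y hY hne hc hc₁
    have hl₁Y : l₁ ∉ Y := fun h' => hc₁ (hc _ h' _ hc₁W h.l₁c₁)
    have ha₁Y : a₁ ∉ Y := fun h' => hc₁ (hc _ h' _ hc₁W h.c₁a₁.symm)
    have hQY : ∀ y ∈ Y, ¬ G.Adj c₁ y := fun y hy h' => hc₁ (hc _ hy _ hc₁W h'.symm)
    have hexit : ∀ a ∈ Y, a ≠ f → ∀ b ∈ S, G.Adj a b → b ∈ Y ∨ b = f := by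
      intro a ha haf b hb hab
      by_contra hn
      rw [not_or] at hn
      by_cases hbL : b ∈ L
      · rcases hL.exit b hbL a (hWS (hY ha)) hab.symm with h' | rfl | h'
        exacts [hWL a (hY ha) h', ha₁Y ha, haf h']
      · by_cases hba : b = a₁
        · subst hba
          rcases hL.adj_a₁ hG h (hWS (hY ha)) hab.symm with h' | h' | rfl | h'
          exacts [hWL a (hY ha) h', haf h', hc₁ ha, hQY a ha h']
        · exact hn.1 (hc a ha b (hW b hb hbL hn.2 hba) hab)
    by_cases hfY : f ∈ Y
    · have := h.not_cut (Y ∪ L) (Finset.union_subset (hY.trans hWS) hL.subset)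
        ⟨f, by simp [hfY]⟩ (by
        intro a ha b hb hab
        rw [Finset.mem_union] at ha ⊢
        rcases ha with ha | ha
        · by_cases haf : a = f
          · by_cases hbL : b ∈ L
            · tauto
            · by_cases hba : b = a₁
              · exact Or.inr hba
              · subst haf
                exact Or.inl (Or.inl (hc _ hfY b (hW b hb hbL hab.ne' hba) hab))
          · rcases hexit a ha haf b hb hab with h' | rfl
            · exact Or.inl (Or.inl h')
            · exact Or.inl (Or.inl hfY)
        · rcases hL.exit a ha b hb hab with h' | h' | rfl
          · exact Or.inl (Or.inr h')
          · exact Or.inr h'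
          · exact Or.inl (Or.inl hfY)) c₁ h.c₁_mem
      rw [Finset.mem_union] at this
      rcases this with (h' | h') | h'
      exacts [hc₁ h', hL.c₁_notMem h', h.c₁a₁.ne h']
    · have hexit' : ∀ a ∈ Y, ∀ b ∈ S, G.Adj a b → b ∈ Y ∨ b = f := fun a ha =>
        hexit a ha fun haf => hfY (haf ▸ ha)
      have hYp : Pend G S Y := ⟨hY.trans hWS, hne, f, hexit'⟩
      have h2 : l₂ ∈ Y ∧ c₂ ∈ Y := by
        rcases h.meets Y hYp with h' | h' | h' | h'
        · exact absurd h' hl₁Y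
        · exact absurd h' hc₁
        · exact ⟨h', hc _ h' _ hc₂W h.l₂c₂⟩
        · exact ⟨hc _ h' _ hl₂W h.l₂c₂.symm, h'⟩
      have hB1 : l₁ ∈ S \ insert f Y := by
        simp [h.l₁_mem, hL.f_ne_l₁.symm, hl₁Y]
      have hB2 : c₁ ∈ S \ insert f Y := by
        simp [h.c₁_mem, hL.f_ne_c₁.symm, hc₁]
      have hcut := h.conn.cut_of_exit (hY.trans hWS) hne hexit' h.c₁_mem hc₁ hL.f_ne_c₁.symm
      rcases h.cut _ _ _ hcut with h' | h'
      · exact h.l₂c₂.ne (Finset.card_le_one.1 h'.le _ h2.1 _ h2.2)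
      · exact h.l₁c₁.ne (Finset.card_le_one.1 h'.le _ hB1 _ hB2)
  intro T hT hne hc
  by_contra hn
  by_cases hc₁ : c₁ ∈ T
  · refine main _ Finset.sdiff_subset (Finset.sdiff_nonempty.2 hn) ?_ (by simp [hc₁])
    intro a ha b hb hab
    rw [Finset.mem_sdiff] at ha ⊢
    exact ⟨hb, fun hbT => ha.2 (hc b hbT a ha.1 hab.symm)⟩
  · exact main T hT hne hc hc₁

/-- By maximality of the leg, every pendant set of the remainder is near one of the leaves. -/
theorem near_leaf (hL : MaxLeg G S l₁ c₁ a₁ l₂ c₂ L f) (hG : ClawFree G)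
    (h : TwoLeaves G S l₁ c₁ a₁ l₂ c₂) {W : Finset V} (hWS : W ⊆ S) (hWL : ∀ v ∈ W, v ∉ L)
    (hW : ∀ v ∈ S, v ∉ L → v ≠ f → v ≠ a₁ → v ∈ W) (hfa : f ∈ W → a₁ ∈ W)
    {T : Finset V} (hT : Pend G W T) :
    (c₁ ∈ T ∨ ∃ t ∈ T, G.Adj c₁ t) ∨ l₂ ∈ T ∨ c₂ ∈ T := by
  obtain ⟨hTW, hne, g, hg⟩ := hT
  by_contra hn
  simp only [not_or, not_exists, not_and] at hn
  obtain ⟨⟨hc₁, hQ⟩, hl₂, hc₂⟩ := hn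
  have ha₁ : a₁ ∉ T := fun h' => hQ _ h' h.c₁a₁
  have hl₁ : l₁ ∉ T := fun h' => hQ _ h' h.l₁c₁.symm
  have hTS := hTW.trans hWS
  have hTL : ∀ t ∈ T, t ∉ L := fun t ht => hWL t (hTW ht)
  by_cases hf : f ∈ T ∨ f ∉ W ∧ ∃ t ∈ T, G.Adj f t
  · -- the leg extends by `f` and `T`
    have hfout : ∀ v ∈ S, v ∉ L → v ≠ a₁ → G.Adj f v → (v ∈ T ∨ v = g) ∧ v ≠ c₁ := by
      intro v hv hvL hva hfv
      have hvW := hW v hv hvL hfv.ne' hva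
      rcases hf with hf | ⟨-, t, ht, hft⟩
      · refine ⟨hg f hf v hvW hfv, ?_⟩
        rintro rfl
        exact hQ f hf hfv.symm
      · by_cases htv : t = v
        · subst htv
          exact ⟨Or.inl ht, by rintro rfl; exact hc₁ ht⟩
        · have hadj := hL.adj_of_adj_out hG (hTS ht) hv (hTL t ht) hvL
            (by rintro rfl; exact ha₁ ht) hva hft hfv htv
          refine ⟨hg t ht v hvW hadj, ?_⟩
          rintro rfl
          exact hQ t ht hadj.symm
    have hm : ∀ v, v ∈ insert f (L ∪ T) ↔ v = f ∨ v ∈ L ∨ v ∈ T := by simp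
    have := hL.max (insert f (L ∪ T)) g ⟨by
        intro v hv
        rcases (hm v).1 hv with rfl | hv | hv
        exacts [hL.f_mem, hL.subset hv, hTS hv], by
        rw [hm, not_or, not_or]; exact ⟨hL.f_ne_c₁.symm, hL.c₁_notMem, hc₁⟩, by
        rw [hm, not_or, not_or]; exact ⟨hL.f_ne_a₁.symm, hL.a₁_notMem, ha₁⟩, by
        intro v hv hcv
        rcases (hm v).1 hv with rfl | hv | hv
        exacts [(hfout c₁ h.c₁_mem hL.c₁_notMem h.c₁a₁.ne hcv.symm).2 rfl, hL.not_adj v hv hcv,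
          hQ v hv hcv], by
        rw [hm, not_or, not_or]; exact ⟨hL.f_ne_l₂.symm, hL.l₂_notMem, hl₂⟩, by
        rw [hm, not_or, not_or]; exact ⟨hL.f_ne_c₂.symm, hL.c₂_notMem, hc₂⟩, by
        obtain ⟨u, hu, hau⟩ := hL.exists_adj
        exact ⟨u, (hm u).2 (Or.inr (Or.inl hu)), hau⟩, by
        intro a ha b hb hab
        rw [hm]
        by_cases hbL : b ∈ L
        · tauto
        by_cases hba : b = a₁
        · exact Or.inr (Or.inl hba)
        by_cases hbf : b = f
        · tauto
        rcases (hm a).1 ha with rfl | ha | ha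
        · have := (hfout b hb hbL hba hab).1
          tauto
        · have := hL.exit a ha b hb hab
          tauto
        · have := hg a ha b (hW b hb hbL hbf hba) hab
          tauto⟩
    have hlt : L ⊂ insert f (L ∪ T) := by
      refine ⟨fun v hv => (hm v).2 (Or.inr (Or.inl hv)), fun h' => hL.f_notMem (h' (by simp))⟩
    exact absurd (Finset.card_lt_card hlt) (by omega)
  · rw [not_or, not_and, not_exists] at hf
    have := h.meets T ⟨hTS, hne, g, fun a ha b hb hab => by
      by_cases hbW : b ∈ W
      · exact hg a ha b hbW hab
      · exfalso
        by_cases hbL : b ∈ L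
        · rcases hL.exit b hbL a (hTS ha) hab.symm with h' | rfl | rfl
          exacts [hTL a ha h', ha₁ ha, hf.1 ha]
        by_cases hbf : b = f
        · subst hbf
          exact hf.2 hbW a ⟨ha, hab.symm⟩
        by_cases hba : b = a₁
        · subst hba
          rcases hL.adj_a₁ hG h (hTS ha) hab.symm with h' | rfl | rfl | h'
          exacts [hTL a ha h', hf.1 ha, hc₁ ha, hQ a ha h']
        exact hbW (hW b hb hbL hbf hba)⟩
    tauto

/-- The two places are the neighbourhood of `c₁` and the pair `l₂`, `c₂`. The leaf `l₁` spoils the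
clique at `c₁`, so pendant sets containing it need separate care. -/
theorem chain_of_compl (hL : MaxLeg G S l₁ c₁ a₁ l₂ c₂ L f) (hG : ClawFree G)
    (h : TwoLeaves G S l₁ c₁ a₁ l₂ c₂) {W : Finset V} (hWS : W ⊆ S) (hWL : ∀ v ∈ W, v ∉ L)
    (hW : ∀ v ∈ S, v ∉ L → v ≠ f → v ≠ a₁ → v ∈ W) (hfa : f ∈ W → a₁ ∈ W) : Chain G W := by
  have hconn := hL.conn_of_compl hG h hWS hWL hW hfa
  have hc₁W := hW _ h.c₁_mem hL.c₁_notMem hL.f_ne_c₁.symm h.c₁a₁.ne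
  have hl₂W := hW _ h.l₂_mem hL.l₂_notMem hL.f_ne_l₂.symm h.a₁_ne_l₂.symm
  refine ⟨hconn, fun T₁ T₂ T₃ h1 h2 h3 h12 h13 h23 => ?_⟩
  have hcl : ∀ v ∈ S, ∀ w ∈ S, v ≠ l₁ → w ≠ l₁ → G.Adj c₁ v → G.Adj c₁ w → v ≠ w →
      G.Adj v w := by
    intro v hv w hw hvl hwl hcv hcw hvw
    rcases hG hcv hcw h.l₁c₁.symm hvw hvl hwl with h' | h' | h'
    · exact h'
    · exact absurd (h.leaf₁ v hv h'.symm) hcv.ne'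
    · exact absurd (h.leaf₁ w hw h'.symm) hcw.ne'
  -- a pendant set seeing `c₁` and separate from `l₁` contains `l₂`
  have far : ∀ T U, Pend G W T → l₁ ∈ U → Sep G T U → (∃ t ∈ T, t ≠ l₁ ∧ G.Adj c₁ t) → l₂ ∈ T := by
    rintro T U ⟨hTW, hne, g, hg⟩ hl hTU ⟨t, ht, htl, hct⟩
    have hc₁T : c₁ ∉ T := fun h' => (hTU _ h' _ hl).2 h.l₁c₁.symm
    have hgc : c₁ = g := (hg t ht c₁ hc₁W hct.symm).resolve_left hc₁T
    -- The exit of `T` is `c₁`, whose neighbours other than `l₁` form a clique; so `T` with `c₁` and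
    -- `l₁` is closed and fills `W`.
    have := @hconn (insert c₁ (insert l₁ T) ∩ W) Finset.inter_subset_right
      ⟨c₁, by simp [hc₁W]⟩ (by
      intro a ha b hb hab
      simp only [Finset.mem_inter, Finset.mem_insert] at ha ⊢
      refine ⟨?_, hb⟩
      by_cases hbl : b = l₁
      · tauto
      rcases ha.1 with rfl | rfl | ha'
      · by_cases htb : t = b
        · subst htb; tauto
        · have := hg t ht b hb (hcl t (hWS (hTW ht)) b (hWS hb) htl hbl hct hab htb)
          rw [← hgc] at this
          tauto
      · exact Or.inl (h.leaf₁ b (hWS hb) hab)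
      · have := hg a ha' b hb hab
        rw [← hgc] at this
        tauto)
    have := Finset.mem_inter.1 (this hl₂W)
    simp only [Finset.mem_insert] at this
    rcases this.1 with h' | h' | h'
    exacts [absurd h' h.c₁_ne_l₂.symm, absurd h' h.l₁_ne_l₂.symm, h']
  have key : ∀ T, Pend G W T →
      (Pend G W T ∧ l₂ ∉ T ∧ (c₁ ∈ T ∨ ∃ t ∈ T, G.Adj c₁ t)) ∨ (l₂ ∈ T ∨ c₂ ∈ T) := by
    intro T hT
    by_cases hl : l₂ ∈ T
    · exact Or.inr (Or.inl hl)
    · exact (hL.near_leaf hG h hWS hWL hW hfa hT).imp_left fun h' => ⟨hT, hl, h'⟩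
  refine false_of_three_of_two
    (P := fun T => Pend G W T ∧ l₂ ∉ T ∧ (c₁ ∈ T ∨ ∃ t ∈ T, G.Adj c₁ t))
    (Q := fun T => l₂ ∈ T ∨ c₂ ∈ T) (key _ h1) (key _ h2) (key _ h3) ?_ ?_ h12 h13 h23
  · have one : ∀ T U, Sep G T U → Pend G W T → Pend G W U → l₂ ∉ U → l₁ ∈ T →
        ¬ (c₁ ∈ U ∨ ∃ u ∈ U, G.Adj c₁ u) := by
      rintro T U hTU hT hU hlU hlT (hc | ⟨u, hu, hcu⟩)
      · exact (hTU _ hlT _ hc).2 h.l₁c₁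
      · exact hlU (far U T hU hlT hTU.symm ⟨u, hu, fun h' => (hTU _ hlT u hu).1 h'.symm, hcu⟩)
    rintro T U hTU ⟨hT, hlT, hcT⟩ ⟨hU, hlU, hcU⟩
    by_cases h1 : l₁ ∈ T
    · exact one T U hTU hT hU hlU h1 hcU
    by_cases h2 : l₁ ∈ U
    · exact one U T hTU.symm hU hT hlT h2 hcT
    rcases hcT with hcT | ⟨t, ht, hct⟩ <;> rcases hcU with hcU | ⟨u, hu, hcu⟩
    · exact (hTU _ hcT _ hcU).1 rfl
    · exact (hTU _ hcT _ hu).2 hcu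
    · exact (hTU _ ht _ hcU).2 hct.symm
    · have := hTU t ht u hu
      exact this.2 (hcl t (hWS (hT.1 ht)) u (hWS (hU.1 hu)) (by rintro rfl; exact h1 ht)
        (by rintro rfl; exact h2 hu) hct hcu this.1)
  · rintro T U hTU (hT | hT) (hU | hU)
    · exact (hTU _ hT _ hU).1 rfl
    · exact (hTU _ hT _ hU).2 h.l₂c₂
    · exact (hTU _ hT _ hU).2 h.l₂c₂.symm
    · exact (hTU _ hT _ hU).1 rfl

theorem fac (hL : MaxLeg G S l₁ c₁ a₁ l₂ c₂ L f) (hG : ClawFree G)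
    (h : TwoLeaves G S l₁ c₁ a₁ l₂ c₂) (h3 : 3 ∣ S.card)
    (ih : ∀ S', S'.card < S.card → Chain G S' → 3 ∣ S'.card → Fac G S') : Fac G S := by
  have hfS := hL.f_mem
  have haS := h.a₁_mem
  have hfL := hL.f_notMem
  have haL := hL.a₁_notMem
  have hfa := hL.f_ne_a₁
  have hLne : 0 < L.card := by
    obtain ⟨u, hu, -⟩ := hL.exists_adj
    exact Finset.card_pos.2 ⟨u, hu⟩
  have main : ∀ X, L ⊆ X → X ⊆ insert f (insert a₁ L) → (a₁ ∈ X → f ∈ X) → 3 ∣ X.card →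
      Fac G S := by
    intro X hLX hXL hX hX3
    have hXS : X ⊆ S := fun v hv => by
      have := hXL hv
      simp only [Finset.mem_insert] at this
      rcases this with rfl | rfl | h'
      exacts [hfS, haS, hL.subset h']
    have hcX : c₁ ∉ X := fun h' => by
      have := hXL h'
      simp only [Finset.mem_insert] at this
      rcases this with h' | h' | h'
      exacts [hL.f_ne_c₁ h'.symm, h.c₁a₁.ne h', hL.c₁_notMem h']
    have hlt : X.card < S.card := Finset.card_lt_card ⟨hXS, fun h' => hcX (h' h.c₁_mem)⟩
    have hcard := Finset.card_sdiff_add_card_eq_card hXS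
    have hXpos := Finset.card_le_card hLX
    have f1 := ih X hlt (hL.chain_of_subset hG h hLX hXL hX) hX3
    have f2 := ih (S \ X) (by omega) (hL.chain_of_compl hG h Finset.sdiff_subset
      (fun v hv hvL => (Finset.mem_sdiff.1 hv).2 (hLX hvL))
      (fun v hv hvL hvf hva => Finset.mem_sdiff.2 ⟨hv, fun hvX => by
        have := hXL hvX
        simp only [Finset.mem_insert] at this
        tauto⟩)
      (fun hf => Finset.mem_sdiff.2 ⟨haS, fun ha => (Finset.mem_sdiff.1 hf).2 (hX ha)⟩))
      (by omega)
    have := f1.union f2 Finset.disjoint_sdiff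
    rwa [Finset.union_sdiff_of_subset hXS] at this
  have e1 : (insert f L).card = L.card + 1 := Finset.card_insert_of_notMem hfL
  have e2 : (insert f (insert a₁ L)).card = L.card + 2 := by
    rw [Finset.card_insert_of_notMem (by simp [hfa, hfL]), Finset.card_insert_of_notMem haL]
  -- Adding none, one or both attachments reaches every residue.
  have : 3 ∣ L.card ∨ 3 ∣ L.card + 1 ∨ 3 ∣ L.card + 2 := by omega
  rcases this with h' | h' | h'
  · exact main L subset_rfl (fun v hv => by simp [hv]) (fun ha => absurd ha haL) h'
  · exact main (insert f L) (Finset.subset_insert _ _) (Finset.insert_subset_insert _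
      (Finset.subset_insert _ _)) (by simp) (by omega)
  · exact main _ (fun v hv => by simp [hv]) subset_rfl (by simp) (by omega)

end MaxLeg

end

/-! ### Graphs whose cuts all split off a leaf -/

theorem pend_singleton {S : Finset V} {l c : V} (hl : l ∈ S) (h : ∀ b ∈ S, G.Adj l b → b = c) :
    Pend G S {l} :=
  ⟨by simpa, by simp, c, fun a ha b hb hab => by
    rw [Finset.mem_singleton] at ha; subst ha; exact Or.inr (h b hb hab)⟩

theorem sep_singleton_left {T : Finset V} {l : V} :
    Sep G {l} T ↔ ∀ t ∈ T, l ≠ t ∧ ¬ G.Adj l t := by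
  simp [Sep]

theorem exists_maxLeg_of_leg {S : Finset V} {c₁ a₁ l₂ c₂ f : V} {X : Finset V}
    (h : Leg G S c₁ a₁ l₂ c₂ X f) : ∃ L g, Leg G S c₁ a₁ l₂ c₂ L g ∧
      ∀ Y g', Leg G S c₁ a₁ l₂ c₂ Y g' → Y.card ≤ L.card := by
  classical
  obtain ⟨L, hL, hmax⟩ := Finset.exists_max_image
    (S.powerset.filter fun X => ∃ g, Leg G S c₁ a₁ l₂ c₂ X g) Finset.card
    ⟨X, Finset.mem_filter.2 ⟨Finset.mem_powerset.2 h.subset, f, h⟩⟩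
  obtain ⟨g, hg⟩ := (Finset.mem_filter.1 hL).2
  exact ⟨L, g, hg, fun Y g' hY => hmax Y
    (Finset.mem_filter.2 ⟨Finset.mem_powerset.2 hY.subset, g', hY⟩)⟩

section

variable {S : Finset V} {l c a : V}

/-- A vertex next to a leaf has a neighbour that is no cut vertex, if all cuts split off one
vertex. -/
theorem exists_not_cut_of_leaf (hS : Chain G S) (h3 : 3 ∣ S.card) (hcard : 3 < S.card)
    (hcut : ∀ c A B, Cut G S c A B → A.card = 1 ∨ B.card = 1) (hl : l ∈ S) (hc : c ∈ S)
    (hlc : G.Adj l c) (hleaf : ∀ b ∈ S, G.Adj l b → b = c) :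
    ∃ a ∈ S, a ≠ l ∧ G.Adj c a ∧ ∀ T ⊆ S, T.Nonempty →
      (∀ u ∈ T, ∀ b ∈ S, G.Adj u b → b ∈ T ∨ b = a) → ∀ v ∈ S, v ∈ T ∨ v = a := by
  have two : ∀ q, ∃ q' ∈ S, q' ≠ l ∧ q' ≠ q ∧ G.Adj c q' := by
    intro q
    by_contra! hn
    obtain ⟨v, hv, hvn⟩ : ∃ v ∈ S, v ∉ ({l, c, q} : Finset V) := by
      by_contra! hsub
      have := Finset.card_le_card hsub
      have := Finset.card_le_three (a := l) (b := c) (c := q)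
      omega
    simp only [Finset.mem_insert, Finset.mem_singleton, not_or] at hvn
    have hC := hS.1.cut_of_exit (T := {l, c}) (g := q) (v := v)
      (by intro w; simp only [Finset.mem_insert, Finset.mem_singleton]; rintro (rfl | rfl) <;> simpa)
      (by simp) (by
        intro u hu b hb hub
        simp only [Finset.mem_insert, Finset.mem_singleton] at hu ⊢
        rcases hu with rfl | rfl
        · have := hleaf b hb hub
          tauto
        · by_contra h'
          simp only [not_or] at h'
          exact hn b hb h'.1.1 h'.2 hub) hv (by simp; tauto) hvn.2.2
    -- The side `{l, c}` has two vertices, so the other has one and `S` has four, which three does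
    -- not divide.
    have e := hC.card_eq
    have e2 : ({l, c} : Finset V).card = 2 := Finset.card_pair hlc.ne
    have := hcut _ _ _ hC
    omega
  by_contra! hn
  -- If all neighbours of `c` other than `l` were cut vertices, two of them would carry leaves,
  -- which with `l` make three separate pendant sets.
  have leafAt : ∀ q ∈ S, q ≠ l → G.Adj c q →
      ∃ l' ∈ S, G.Adj l' q ∧ ∀ b ∈ S, G.Adj l' b → b = q := by
    intro q hq hql hcq
    by_contra hno
    obtain ⟨T, hT, hne, hex, v, hv, hvT⟩ := hn q hq hql hcq
    have hC := hS.1.cut_of_exit hT hne hex hv hvT.1 hvT.2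
    rcases hcut _ _ _ hC with h' | h'
    · obtain ⟨l', h1, -, h2⟩ := hC.exists_leaf hS.1 h'
      exact hno ⟨l', h1, h2⟩
    · obtain ⟨l', h1, -, h2⟩ := hC.symm.exists_leaf hS.1 h'
      exact hno ⟨l', h1, h2⟩
  obtain ⟨q, hq, hql, -, hcq⟩ := two l
  obtain ⟨q', hq', hql', hqq', hcq'⟩ := two q
  obtain ⟨m, hm, hmq, hmleaf⟩ := leafAt q hq hql hcq
  obtain ⟨m', hm', hmq', hmleaf'⟩ := leafAt q' hq' hql' hcq'
  have side : ∀ q m, q ≠ l → G.Adj c q → G.Adj m q → (∀ b ∈ S, G.Adj m b → b = q) →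
      Sep G {l} {m} := by
    intro q m hql hcq hmq hmleaf
    rw [sep_singleton_left]
    intro t ht
    rw [Finset.mem_singleton] at ht
    subst ht
    have hmc : t ≠ c := by
      rintro rfl
      exact hql (hmleaf l hl hlc.symm).symm
    refine ⟨?_, fun hlm => ?_⟩
    · rintro rfl
      exact hcq.ne (hmleaf c hc hlc)
    · by_cases hmS : t ∈ S
      · exact hmc (hleaf t hmS hlm)
      · exact hql (hmleaf l hl hlm.symm).symm
  refine hS.2 (pend_singleton hl hleaf) (pend_singleton hm hmleaf) (pend_singleton hm' hmleaf')
    (side q m hql hcq hmq hmleaf) (side q' m' hql' hcq' hmq' hmleaf') ?_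
  rw [sep_singleton_left]
  intro t ht
  rw [Finset.mem_singleton] at ht
  subst ht
  refine ⟨?_, fun hmm => ?_⟩
  · rintro rfl
    exact hqq' (hmleaf q' hq' hmq')
  · have e1 := hmleaf t hm' hmm
    subst e1
    exact hcq'.ne (hmleaf' c hc hcq.symm)

/-- Every closed part of the remainder sees `c`, because `a` is no cut vertex; the neighbours of `c`
other than `l` form a clique, so there is only one such part. -/
theorem conn_sdiff_of_leaf (hG : ClawFree G) (hl : l ∈ S) (hc : c ∈ S)
    (hlc : G.Adj l c) (hleaf : ∀ b ∈ S, G.Adj l b → b = c) (hca : G.Adj c a)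
    (hnc : ∀ T ⊆ S, T.Nonempty → (∀ u ∈ T, ∀ b ∈ S, G.Adj u b → b ∈ T ∨ b = a) →
      ∀ v ∈ S, v ∈ T ∨ v = a) : Conn G (S \ {l, c, a}) := by
  have hm : ∀ v, v ∈ S \ {l, c, a} ↔ v ∈ S ∧ v ≠ l ∧ v ≠ c ∧ v ≠ a := by intro v; simp
  have side : ∀ Y ⊆ S \ {l, c, a}, Y.Nonempty →
      (∀ u ∈ Y, ∀ b ∈ S \ {l, c, a}, G.Adj u b → b ∈ Y) → ∃ y ∈ Y, G.Adj c y := by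
    intro Y hY hne hex
    by_contra! hn
    have := hnc Y (fun v hv => ((hm v).1 (hY hv)).1) hne (by
      intro u hu b hb hub
      by_cases hba : b = a
      · exact Or.inr hba
      have hbc : b ≠ c := by rintro rfl; exact hn u hu hub.symm
      have hbl : b ≠ l := by
        rintro rfl
        have hu' := (hm u).1 (hY hu)
        exact hu'.2.2.1 (hleaf u hu'.1 hub.symm)
      exact Or.inl (hex u hu b ((hm b).2 ⟨hb, hbl, hbc, hba⟩) hub)) c hc
    rcases this with h' | h'
    · exact ((hm c).1 (hY h')).2.2.1 rfl
    · exact hca.ne h'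
  intro T hT hne hex
  by_contra hn
  obtain ⟨t, ht, hct⟩ := side T hT hne hex
  obtain ⟨u, hu, hcu⟩ := side _ Finset.sdiff_subset (Finset.sdiff_nonempty.2 hn) (by
    intro a ha b hb hab
    rw [Finset.mem_sdiff] at ha ⊢
    exact ⟨hb, fun hbT => ha.2 (hex b hbT a ha.1 hab.symm)⟩)
  rw [Finset.mem_sdiff] at hu
  have htS := (hm t).1 (hT ht)
  have huS := (hm u).1 hu.1
  rcases hG hct hcu hlc.symm (by rintro rfl; exact hu.2 ht) htS.2.1 huS.2.1 with h' | h' | h'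
  · exact hu.2 (hex t ht u hu.1 h')
  · exact htS.2.2.1 (hleaf t htS.1 h'.symm)
  · exact huS.2.2.1 (hleaf u huS.1 h'.symm)

/-- If deleting the path `l c a` leaves two end-blocks away from `c`, there is a leg to split off. -/
theorem Chain.fac_of_leaf_of_sep (hS : Chain G S) (hG : ClawFree G) (h3 : 3 ∣ S.card)
    (ih : ∀ S', S'.card < S.card → Chain G S' → 3 ∣ S'.card → Fac G S')
    (hcut : ∀ c A B, Cut G S c A B → A.card = 1 ∨ B.card = 1) (hl : l ∈ S) (hc : c ∈ S)
    (hlc : G.Adj l c) (hleaf : ∀ b ∈ S, G.Adj l b → b = c) (ha : a ∈ S) (hal : a ≠ l)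
    (hca : G.Adj c a)
    (hnc : ∀ T ⊆ S, T.Nonempty → (∀ u ∈ T, ∀ b ∈ S, G.Adj u b → b ∈ T ∨ b = a) →
      ∀ v ∈ S, v ∈ T ∨ v = a) {U W : Finset V} (hU : Pend G (S \ {l, c, a}) U)
    (hW : Pend G (S \ {l, c, a}) W) (hUW : Sep G U W) (hcU : ∀ t ∈ U, ¬ G.Adj c t)
    (hcW : ∀ t ∈ W, ¬ G.Adj c t) (haU : ∃ t ∈ U, G.Adj a t) (haW : ∀ t ∈ W, ¬ G.Adj a t) :
    Fac G S := by
  have hm : ∀ v, v ∈ S \ {l, c, a} ↔ v ∈ S ∧ v ≠ l ∧ v ≠ c ∧ v ≠ a := by intro v; simp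
  obtain ⟨hUS, hUne, f, hf⟩ := hU
  obtain ⟨hWS, hWne, g, hg⟩ := hW
  have hWex : ∀ u ∈ W, ∀ b ∈ S, G.Adj u b → b ∈ W ∨ b = g := by
    intro u hu b hb hub
    have hu' := (hm u).1 (hWS hu)
    refine hg u hu b ((hm b).2 ⟨hb, ?_, ?_, ?_⟩) hub
    · rintro rfl; exact hu'.2.2.1 (hleaf u hu'.1 hub.symm)
    · rintro rfl; exact hcW u hu hub.symm
    · rintro rfl; exact haW u hu hub.symm
  have hWS' : W ⊆ S := hWS.trans Finset.sdiff_subset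
  have hlW : l ∉ W := fun h' => ((hm l).1 (hWS h')).2.1 rfl
  have hcW' : c ∉ W := fun h' => ((hm c).1 (hWS h')).2.2.1 rfl
  have haW' : a ∉ W := fun h' => ((hm a).1 (hWS h')).2.2.2 rfl
  -- `W` is pendant in `S`. At least two of `l`, `c`, `a` differ from its exit `g` and lie across
  -- the cut there, so `W` must be the single-vertex side.
  obtain ⟨v, w, hv, hw, hvw, hvW, hwW, hvg, hwg⟩ :
      ∃ v w, v ∈ S ∧ w ∈ S ∧ v ≠ w ∧ v ∉ W ∧ w ∉ W ∧ v ≠ g ∧ w ≠ g := by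
    by_cases h1 : l = g
    · exact ⟨c, a, hc, ha, hca.ne, hcW', haW', h1 ▸ hlc.ne', h1 ▸ hal⟩
    · by_cases h2 : c = g
      · exact ⟨l, a, hl, ha, hal.symm, hlW, haW', h1, h2 ▸ hca.ne'⟩
      · exact ⟨l, c, hl, hc, hlc.ne, hlW, hcW', h1, h2⟩
  have hC := hS.1.cut_of_exit hWS' hWne hWex hv hvW hvg
  have hcard : W.card = 1 := by
    refine (hcut _ _ _ hC).resolve_right fun h' => hvw ?_
    exact Finset.card_le_one.1 h'.le _ (by simp [hv, hvW, hvg]) _ (by simp [hw, hwW, hwg])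
  obtain ⟨m, hmS, rfl, hmg, hmleaf⟩ := hC.exists_leaf hS.1 hcard
  have hmR := (hm m).1 (hWS (by simp))
  have hgS : g ∈ S := (hC.mem_iff g).2 (Or.inl rfl)
  have ham : ¬ G.Adj a m := haW m (by simp)
  have hUm : ∀ u ∈ U, u ≠ m ∧ ¬ G.Adj u m := fun u hu => hUW u hu m (by simp)
  have hTL : TwoLeaves G S l c a m g := by
    refine ⟨hS.1, hl, hc, ha, hmS, hgS, hlc, hmg, hca, hleaf, hmleaf, hal, hmR.2.1.symm,
      hmR.2.2.1.symm, hmR.2.2.2.symm, ?_, hnc, ?_, hcut⟩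
    · rintro rfl; exact ham hmg.symm
    -- A pendant set avoiding both leaves and their attachments would be a third one, separate from
    -- `{l}` and `{m}`.
    · intro T hT
      by_contra hn
      simp only [not_or] at hn
      refine hS.2 (pend_singleton hl hleaf) (pend_singleton hmS hmleaf) hT ?_ ?_ ?_
      · rw [sep_singleton_left]
        intro t ht
        rw [Finset.mem_singleton] at ht
        subst ht
        exact ⟨hmR.2.1.symm, fun h' => hmR.2.2.1 (hleaf t hmS h')⟩
      · rw [sep_singleton_left]
        intro t ht
        refine ⟨by rintro rfl; exact hn.1 ht, fun h' => ?_⟩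
        exact hn.2.1 (hleaf t (hT.1 ht) h' ▸ ht)
      · rw [sep_singleton_left]
        intro t ht
        refine ⟨by rintro rfl; exact hn.2.2.1 ht, fun h' => ?_⟩
        exact hn.2.2.2 (hmleaf t (hT.1 ht) h' ▸ ht)
  have hLeg : Leg G S c a m g U f := by
    refine ⟨hUS.trans Finset.sdiff_subset, fun h' => ((hm c).1 (hUS h')).2.2.1 rfl,
      fun h' => ((hm a).1 (hUS h')).2.2.2 rfl, hcU, fun h' => (hUm m h').1 rfl,
      fun h' => (hUm g h').2 hmg.symm, haU, ?_⟩
    intro u hu b hb hub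
    by_cases hba : b = a
    · exact Or.inr (Or.inl hba)
    have hu' := (hm u).1 (hUS hu)
    have hbl : b ≠ l := by rintro rfl; exact hu'.2.2.1 (hleaf u hu'.1 hub.symm)
    have hbc : b ≠ c := by rintro rfl; exact hcU u hu hub.symm
    exact (hf u hu b ((hm b).2 ⟨hb, hbl, hbc, hba⟩) hub).imp_right Or.inr
  obtain ⟨L, f', hL, hmax⟩ := exists_maxLeg_of_leg hLeg
  exact (hL.maxLeg hG hTL hmax).fac hG hTL h3 ih

theorem Chain.fac_of_leaf (hS : Chain G S) (hG : ClawFree G) (h3 : 3 ∣ S.card) (hcard : 3 < S.card)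
    (ih : ∀ S', S'.card < S.card → Chain G S' → 3 ∣ S'.card → Fac G S')
    (hcut : ∀ c A B, Cut G S c A B → A.card = 1 ∨ B.card = 1) (hl : l ∈ S) (hc : c ∈ S)
    (hlc : G.Adj l c) (hleaf : ∀ b ∈ S, G.Adj l b → b = c) : Fac G S := by
  obtain ⟨a, ha, hal, hca, hnc⟩ := exists_not_cut_of_leaf hS h3 hcard hcut hl hc hlc hleaf
  have hm : ∀ v, v ∈ S \ {l, c, a} ↔ v ∈ S ∧ v ≠ l ∧ v ≠ c ∧ v ≠ a := by intro v; simp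
  have hconn := conn_sdiff_of_leaf hG hl hc hlc hleaf hca hnc
  have hsub : ({l, c, a} : Finset V) ⊆ S := by
    intro v hv
    simp only [Finset.mem_insert, Finset.mem_singleton] at hv
    rcases hv with rfl | rfl | rfl <;> assumption
  have e := Finset.card_sdiff_add_card_eq_card hsub
  have e3 : ({l, c, a} : Finset V).card = 3 :=
    Finset.card_eq_three.2 ⟨l, c, a, hlc.ne, hal.symm, hca.ne, rfl⟩
  by_cases hR : Chain G (S \ {l, c, a})
  · have := (ih _ (by omega) hR (by omega)).union (Fac.triple hal.symm hlc hca)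
      Finset.sdiff_disjoint
    rwa [Finset.sdiff_union_of_subset hsub] at this
  by_contra hF
  have hcl : ∀ v ∈ S \ {l, c, a}, ∀ w ∈ S \ {l, c, a}, G.Adj c v → G.Adj c w → v ≠ w →
      G.Adj v w := by
    intro v hv w hw hcv hcw hvw
    have hv' := (hm v).1 hv
    have hw' := (hm w).1 hw
    rcases hG hcv hcw hlc.symm hvw hv'.2.1 hw'.2.1 with h' | h' | h'
    · exact h'
    · exact absurd (hleaf v hv'.1 h'.symm) hcv.ne'
    · exact absurd (hleaf w hw'.1 h'.symm) hcw.ne'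
  have pendS : ∀ T, Pend G (S \ {l, c, a}) T → (∀ t ∈ T, ¬ G.Adj c t) → (∀ t ∈ T, ¬ G.Adj a t) →
      Pend G S T := by
    rintro T ⟨hT, hne, g, hg⟩ hcT haT
    refine ⟨hT.trans Finset.sdiff_subset, hne, g, fun u hu b hb hub => ?_⟩
    have hu' := (hm u).1 (hT hu)
    refine hg u hu b ((hm b).2 ⟨hb, ?_, ?_, ?_⟩) hub
    · rintro rfl; exact hu'.2.2.1 (hleaf u hu'.1 hub.symm)
    · rintro rfl; exact hcT u hu hub.symm
    · rintro rfl; exact haT u hu hub.symm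
  have sepl : ∀ T ⊆ S \ {l, c, a}, Sep G {l} T := by
    intro T hT
    rw [sep_singleton_left]
    intro t ht
    have ht' := (hm t).1 (hT ht)
    exact ⟨ht'.2.1.symm, fun h' => ht'.2.2.1 (hleaf t ht'.1 h')⟩
  -- If both sets see `a`, there is a claw at `a` with `c`; if neither does, both are pendant in `S`
  -- besides `{l}`; if exactly one does, it is a leg. Of three separate sets at most one sees `c`,
  -- so such a pair always exists.
  have pair : ∀ U W, Pend G (S \ {l, c, a}) U → Pend G (S \ {l, c, a}) W → Sep G U W →
      (∀ t ∈ U, ¬ G.Adj c t) → (∀ t ∈ W, ¬ G.Adj c t) → False := by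
    intro U W hU hW hUW hcU hcW
    by_cases haU : ∃ t ∈ U, G.Adj a t
    · by_cases haW : ∃ t ∈ W, G.Adj a t
      · obtain ⟨t, ht, hat⟩ := haU
        obtain ⟨w, hw, haw⟩ := haW
        have h1 := hUW t ht w hw
        have h2 := ((hm t).1 (hU.1 ht)).2.2.1
        have h3 := ((hm w).1 (hW.1 hw)).2.2.1
        rcases hG hca.symm hat haw h2.symm h3.symm h1.1 with h' | h' | h'
        exacts [hcU t ht h', hcW w hw h', h1.2 h']
      · push Not at haW
        exact hF (hS.fac_of_leaf_of_sep hG h3 ih hcut hl hc hlc hleaf ha hal hca hnc hU hW hUW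
          hcU hcW haU haW)
    · by_cases haW : ∃ t ∈ W, G.Adj a t
      · push Not at haU
        exact hF (hS.fac_of_leaf_of_sep hG h3 ih hcut hl hc hlc hleaf ha hal hca hnc hW hU
          hUW.symm hcW hcU haW haU)
      · push Not at haU haW
        exact hS.2 (pend_singleton hl hleaf) (pendS U hU hcU haU) (pendS W hW hcW haW)
          (sepl U hU.1) (sepl W hW.1) hUW
  refine hR ⟨hconn, fun T₁ T₂ T₃ h1 h2 h3 h12 h13 h23 => ?_⟩
  have excl : ∀ T U, Pend G (S \ {l, c, a}) T → Pend G (S \ {l, c, a}) U → Sep G T U →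
      (∃ t ∈ T, G.Adj c t) → ∀ t ∈ U, ¬ G.Adj c t := by
    rintro T U hT hU hTU ⟨t, ht, hct⟩ u hu hcu
    have := hTU t ht u hu
    exact this.2 (hcl t (hT.1 ht) u (hU.1 hu) hct hcu this.1)
  by_cases q1 : ∃ t ∈ T₁, G.Adj c t
  · exact pair T₂ T₃ h2 h3 h23 (excl _ _ h1 h2 h12 q1) (excl _ _ h1 h3 h13 q1)
  by_cases q2 : ∃ t ∈ T₂, G.Adj c t
  · exact pair T₁ T₃ h1 h3 h13 (excl _ _ h2 h1 h12.symm q2) (excl _ _ h2 h3 h23 q2)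
  push Not at q1 q2
  exact pair T₁ T₂ h1 h2 h12 q1 q2

end

/-! ### The induction on the order -/

/-- A connected claw-free graph with at most two end-blocks, whose number of vertices is divisible
by three, is partitioned into three-vertex paths. -/
theorem Chain.fac (hG : ClawFree G) {S : Finset V} (hS : Chain G S) (h3 : 3 ∣ S.card) :
    Fac G S := by
  induction hn : S.card using Nat.strong_induction_on generalizing S with
  | _ n ih =>
    have ih' : ∀ S', S'.card < S.card → Chain G S' → 3 ∣ S'.card → Fac G S' :=
      fun S' h1 h2 h4 => ih _ (hn ▸ h1) h2 h4 rfl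
    rcases Nat.lt_or_ge 3 S.card with hcard | hcard
    · by_cases h2 : Conn2 G S
      · by_cases h3' : Conn3 G S
        · obtain ⟨x, hx⟩ : S.Nonempty := Finset.card_pos.1 (by omega)
          obtain ⟨y, hy, hxy⟩ : ∃ y ∈ S, G.Adj x y := by
            by_contra! hno
            have := @hS.1 {x} (by simpa) (by simp) (by
              intro a ha b hb hab
              rw [Finset.mem_singleton] at ha
              subst ha
              exact absurd hab (hno b hb))
            have := Finset.card_le_card this
            simp at this
            omega
          obtain ⟨z, z', -, hz⟩ := h3'.exists_two_chain hG hcard hx hy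
          obtain ⟨hzS, hyz, hz⟩ := hz z (Or.inl rfl)
          simp only [Finset.mem_sdiff, Finset.mem_insert, Finset.mem_singleton, not_or] at hzS
          have hsub : ({x, y, z} : Finset V) ⊆ S := by
            intro v hv
            simp only [Finset.mem_insert, Finset.mem_singleton] at hv
            rcases hv with rfl | rfl | rfl
            exacts [hx, hy, hzS.1]
          have hset : (S \ {x, y}).erase z = S \ {x, y, z} := by
            ext v
            simp only [Finset.mem_erase, Finset.mem_sdiff, Finset.mem_insert,
              Finset.mem_singleton]
            tauto
          rw [hset] at hz
          have e := Finset.card_sdiff_add_card_eq_card hsub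
          have e3 : ({x, y, z} : Finset V).card = 3 :=
            Finset.card_eq_three.2 ⟨x, y, z, hxy.ne, Ne.symm hzS.2.1, hyz.ne, rfl⟩
          have := (ih' _ (by omega) hz (by omega)).union (Fac.triple (Ne.symm hzS.2.1) hxy hyz)
            Finset.sdiff_disjoint
          rwa [Finset.sdiff_union_of_subset hsub] at this
        · obtain ⟨x, y, A, B, h⟩ := h2.exists_cut2 h3'
          exact h.fac h2 hG h3 ih'
      · by_contra hF
        have hcut : ∀ c A B, Cut G S c A B → A.card = 1 ∨ B.card = 1 := fun c A B h =>
          (h.fac_or_card_eq_one hS hG h3 ih').resolve_left hF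
        obtain ⟨c, A, B, h⟩ := hS.1.exists_cut h2
        have hc : c ∈ S := (h.mem_iff c).2 (Or.inl rfl)
        rcases hcut c A B h with h' | h'
        · obtain ⟨l, hl, -, hlc, hleaf⟩ := h.exists_leaf hS.1 h'
          exact hF (hS.fac_of_leaf hG h3 hcard ih' hcut hl hc hlc hleaf)
        · obtain ⟨l, hl, -, hlc, hleaf⟩ := h.symm.exists_leaf hS.1 h'
          exact hF (hS.fac_of_leaf hG h3 hcard ih' hcut hl hc hlc hleaf)
    · rcases Nat.eq_zero_or_pos S.card with h0 | h0
      · rw [Finset.card_eq_zero.1 h0]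
        exact Fac.nil
      · exact hS.1.fac_of_card (by omega)

end

/-! ### Passing between vertex sets and Mathlib's graphs -/

section

variable {V : Type*} {G : SimpleGraph V}

theorem IsClawFree.clawFree (h : IsClawFree G) : ClawFree G := by
  intro v a b c hva hvb hvc hab hac hbc
  by_contra hn
  simp only [not_or] at hn
  let φ : Fin 1 ⊕ Fin 3 → V := Sum.elim (fun _ => v) ![a, b, c]
  have hφ : Function.Injective φ := by
    rintro (i | i) (j | j) hij
    · exact congrArg _ (Subsingleton.elim i j)
    · fin_cases j
      exacts [absurd hij hva.ne, absurd hij hvb.ne, absurd hij hvc.ne]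
    · fin_cases i
      exacts [absurd hij hva.ne', absurd hij hvb.ne', absurd hij hvc.ne']
    · fin_cases i <;> fin_cases j <;> simp_all [φ]
  have hadj : ∀ p q, G.Adj (φ p) (φ q) ↔ (completeBipartiteGraph (Fin 1) (Fin 3)).Adj p q := by
    rintro (i | i) (j | j)
    · simp [φ]
    · fin_cases j <;> simp [φ, hva, hvb, hvc]
    · fin_cases i <;> simp [φ, hva.symm, hvb.symm, hvc.symm]
    · fin_cases i <;> fin_cases j <;>
        simp [φ, hn, G.adj_comm b a, G.adj_comm c a, G.adj_comm c b]
  exact h ⟨⟨⟨φ, hφ⟩, fun {p q} => hadj p q⟩⟩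

theorem IsKConnected.conn3 [Fintype V] [DecidableEq V] (h : IsKConnected G 3) :
    Conn3 G Finset.univ := by
  intro T _ hne g k hex v _
  by_contra! hv
  obtain ⟨t, ht⟩ := hne
  -- An exit may lie in `T`; such vertices are not deleted, so that `T` survives intact in the
  -- remainder.
  let X : Finset V := ({g, k} : Finset V) \ T
  have hX : X.card < 3 :=
    lt_of_le_of_lt ((Finset.card_le_card Finset.sdiff_subset).trans Finset.card_le_two) (by simp)
  have hc := h.2 X hX
  have htX : t ∉ X := by simp [X, ht]
  have hvX : v ∉ X := by simp [X, hv.2.1, hv.2.2]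
  obtain ⟨p⟩ := hc.preconnected ⟨t, htX⟩ ⟨v, hvX⟩
  have : ∀ a b : {w | w ∉ X}, (G.induce {w | w ∉ X}).Walk a b → (a : V) ∈ T → (b : V) ∈ T := by
    intro a b p
    induction p with
    | nil => exact id
    | @cons a b c hab p ih =>
      intro ha
      refine ih ?_
      rcases hex a ha b (Finset.mem_univ _) hab with h' | h' | h'
      · exact h'
      · by_contra hb
        exact b.2 (by simp [X, h'] at hb ⊢; exact hb)
      · by_contra hb
        exact b.2 (by simp [X, h'] at hb ⊢; exact hb)
  exact hv.1 (this _ _ p ht)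

theorem Conn.induce_connected {S : Finset V} (h : Conn G S) (hne : S.Nonempty) {T : Set V}
    (hT : ∀ v, v ∈ T ↔ v ∈ S) : (G.induce T).Connected := by
  classical
  obtain ⟨s, hs⟩ := hne
  have : Nonempty T := ⟨⟨s, (hT s).2 hs⟩⟩
  refine ⟨fun u v => ?_⟩
  have := @h (S.filter fun w => ∃ hw : w ∈ T, (G.induce T).Reachable u ⟨w, hw⟩)
    (Finset.filter_subset _ _)
    ⟨u, Finset.mem_filter.2 ⟨(hT u).1 u.2, u.2, SimpleGraph.Reachable.refl u⟩⟩ (by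
    intro a ha b hb hab
    obtain ⟨-, haT, hr⟩ := Finset.mem_filter.1 ha
    refine Finset.mem_filter.2 ⟨hb, (hT b).2 hb, hr.trans (SimpleGraph.Adj.reachable ?_)⟩
    exact hab)
  obtain ⟨-, hv, hr⟩ := Finset.mem_filter.1 (this ((hT v).1 v.2))
  exact hr

/-- The component of `b` in `K` is the path `a b c`. -/
structure PathComponent (K : SimpleGraph V) (a b c : V) : Prop where
  ne : a ≠ c
  left : K.Adj a b
  right : K.Adj b c
  left_exit : ∀ w, K.Adj a w → w = b
  mid_exit : ∀ w, K.Adj b w → w = a ∨ w = c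
  right_exit : ∀ w, K.Adj c w → w = b

/-- `K` is a subgraph of `G` whose nontrivial components are three-vertex paths covering `S`. -/
structure Packs (G K : SimpleGraph V) (S : Finset V) : Prop where
  le : K ≤ G
  mem : ∀ u v, K.Adj u v → u ∈ S
  cover : ∀ v ∈ S, ∃ a b c, PathComponent K a b c ∧ (v = a ∨ v = b ∨ v = c)

/-- The adjacency in the conclusion lets a factor be built around a prescribed edge. -/
theorem Packs.insert_path [DecidableEq V] {K : SimpleGraph V} {S : Finset V} (h : Packs G K S)
    {a b c : V} (ha : a ∉ S) (hb : b ∉ S) (hc : c ∉ S) (hac : a ≠ c) (hab : G.Adj a b)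
    (hbc : G.Adj b c) :
    ∃ K', Packs G K' (insert a (insert b (insert c S))) ∧ K'.Adj a b := by
  let K' : SimpleGraph V :=
    { Adj := fun u v => K.Adj u v ∨ (u = a ∧ v = b) ∨ (u = b ∧ v = a) ∨ (u = b ∧ v = c) ∨
        (u = c ∧ v = b)
      symm := ⟨fun u v huv => by
        rcases huv with h' | h' | h' | h' | h'
        · exact Or.inl h'.symm
        all_goals tauto⟩
      loopless := ⟨fun u hu => by
        rcases hu with h' | ⟨rfl, h'⟩ | ⟨rfl, h'⟩ | ⟨rfl, h'⟩ | ⟨rfl, h'⟩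
        exacts [K.loopless.irrefl u h', hab.ne h', hab.ne' h', hbc.ne h', hbc.ne' h']⟩ }
  have hK' : ∀ u v, K'.Adj u v ↔ K.Adj u v ∨ (u = a ∧ v = b) ∨ (u = b ∧ v = a) ∨
    (u = b ∧ v = c) ∨ (u = c ∧ v = b) := fun u v => Iff.rfl
  have old : ∀ u v, K.Adj u v → u ∈ S ∧ v ∈ S := fun u v huv => ⟨h.mem u v huv, h.mem v u huv.symm⟩
  have new : ∀ u ∈ S, ∀ v, K'.Adj u v ↔ K.Adj u v := by
    intro u hu v
    have h1 : u ≠ a := by rintro rfl; exact ha hu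
    have h2 : u ≠ b := by rintro rfl; exact hb hu
    have h3 : u ≠ c := by rintro rfl; exact hc hu
    simp [hK', h1, h2, h3]
  have na : ∀ v, ¬ K.Adj a v := fun v hv => ha (h.mem _ _ hv)
  have nb : ∀ v, ¬ K.Adj b v := fun v hv => hb (h.mem _ _ hv)
  have nc : ∀ v, ¬ K.Adj c v := fun v hv => hc (h.mem _ _ hv)
  have hpath : PathComponent K' a b c := by
    refine ⟨hac, by simp [hK'], by simp [hK'], fun w hw => ?_, fun w hw => ?_, fun w hw => ?_⟩
    · simpa [hK', na, hac, hab.ne] using hw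
    · simpa [hK', nb, hab.ne', hbc.ne] using hw
    · simpa [hK', nc, hac.symm, hbc.ne'] using hw
  refine ⟨K', ⟨?_, ?_, ?_⟩, hpath.left⟩
  · rintro u v (h' | ⟨rfl, rfl⟩ | ⟨rfl, rfl⟩ | ⟨rfl, rfl⟩ | ⟨rfl, rfl⟩)
    exacts [h.le h', hab, hab.symm, hbc, hbc.symm]
  · rintro u v (h' | ⟨rfl, rfl⟩ | ⟨rfl, rfl⟩ | ⟨rfl, rfl⟩ | ⟨rfl, rfl⟩)
    · simp [h.mem u v h']
    all_goals simp
  · intro v hv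
    by_cases hvS : v ∈ S
    · obtain ⟨a', b', c', hp, hv'⟩ := h.cover v hvS
      have ha' := (old _ _ hp.left).1
      have hb' := (old _ _ hp.left).2
      have hc' := (old _ _ hp.right).2
      exact ⟨a', b', c', ⟨hp.ne, (new _ ha' _).2 hp.left, (new _ hb' _).2 hp.right,
        fun w hw => hp.left_exit w ((new _ ha' _).1 hw),
        fun w hw => hp.mid_exit w ((new _ hb' _).1 hw),
        fun w hw => hp.right_exit w ((new _ hc' _).1 hw)⟩, hv'⟩
    · refine ⟨a, b, c, hpath, ?_⟩
      simp only [Finset.mem_insert] at hv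
      tauto

theorem Fac.exists_packs [DecidableEq V] {S : Finset V} (h : Fac G S) : ∃ K, Packs G K S := by
  induction h with
  | nil => exact ⟨⊥, ⟨bot_le, fun u v h => absurd h (by simp), by simp⟩⟩
  | cons _ ha hb hc hac hab hbc ih =>
    obtain ⟨K, hK⟩ := ih
    obtain ⟨K', hK', -⟩ := hK.insert_path ha hb hc hac hab hbc
    exact ⟨K', hK'⟩

theorem isLambdaFactor_of_pathComponent {F : G.Subgraph} (hs : F.IsSpanning)
    (h : ∀ v, ∃ a b c, PathComponent F.coe a b c ∧ (v = a ∨ v = b ∨ v = c)) :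
    IsLambdaFactor F := by
  refine ⟨hs, fun C => ?_⟩
  induction C using SimpleGraph.ConnectedComponent.ind with
  | _ v =>
    obtain ⟨a, b, c, hp, hv⟩ := h v
    have hab := hp.left.ne
    have hbc := hp.right.ne
    have hac := hp.ne
    have hba : F.coe.connectedComponentMk v = F.coe.connectedComponentMk b := by
      rcases hv with rfl | rfl | rfl
      exacts [SimpleGraph.ConnectedComponent.sound hp.left.reachable, rfl,
        SimpleGraph.ConnectedComponent.sound hp.right.symm.reachable]
    rw [hba]
    have closed : ∀ u w, F.coe.Walk u w → (u = a ∨ u = b ∨ u = c) → (w = a ∨ w = b ∨ w = c) := by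
      intro u w p
      induction p with
      | nil => exact id
      | @cons u x w hux p ih =>
        rintro (rfl | rfl | rfl)
        · exact ih (Or.inr (Or.inl (hp.left_exit _ hux)))
        · exact ih (by have := hp.mid_exit _ hux; tauto)
        · exact ih (Or.inr (Or.inl (hp.right_exit _ hux)))
    have ma : a ∈ (F.coe.connectedComponentMk b) :=
      SimpleGraph.ConnectedComponent.sound hp.left.reachable
    have mb : b ∈ (F.coe.connectedComponentMk b) := rfl
    have mc : c ∈ (F.coe.connectedComponentMk b) :=
      SimpleGraph.ConnectedComponent.sound hp.right.symm.reachable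
    let φ : Fin 3 → (F.coe.connectedComponentMk b) := ![⟨a, ma⟩, ⟨b, mb⟩, ⟨c, mc⟩]
    have hφ : Function.Bijective φ := by
      constructor
      · intro i j hij
        fin_cases i <;> fin_cases j <;> simp_all [φ]
      · rintro ⟨w, hw⟩
        obtain ⟨p⟩ := SimpleGraph.ConnectedComponent.exact hw
        rcases closed _ _ p.reverse (Or.inr (Or.inl rfl)) with rfl | rfl | rfl
        exacts [⟨0, rfl⟩, ⟨1, rfl⟩, ⟨2, rfl⟩]
    have nac : ¬ F.coe.Adj a c := fun h' => hbc (hp.left_exit _ h').symm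
    refine ⟨SimpleGraph.Iso.symm ⟨Equiv.ofBijective φ hφ, ?_⟩⟩
    intro i j
    have e : ∀ i j, (F.coe.connectedComponentMk b).toSimpleGraph.Adj (φ i) (φ j) ↔
      F.coe.Adj (φ i : F.verts) (φ j) := fun i j => Iff.rfl
    rw [Equiv.ofBijective_apply, Equiv.ofBijective_apply, e, SimpleGraph.pathGraph_adj]
    have hab' : F.Adj a b := hp.left
    have hbc' : F.Adj b c := hp.right
    have nac' : ¬ F.Adj a c := nac
    fin_cases i <;> fin_cases j <;>
      simp [φ, hab', hbc', hab'.symm, hbc'.symm, nac', F.adj_comm c a]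

/-- Pulling back along an embedding serves both uses: the inclusion of `G - L` for (1) and the
identity of `G` for (2). -/
theorem Packs.exists_isLambdaFactor {W : Type*} {H : SimpleGraph W} {K : SimpleGraph V}
    {S : Finset V} (h : Packs G K S) (f : H ↪g G) (hf : ∀ v, v ∈ S ↔ ∃ w, f w = v) :
    ∃ F : H.Subgraph, IsLambdaFactor F ∧ ∀ u v, F.Adj u v ↔ K.Adj (f u) (f v) := by
  have hle : K.comap f ≤ H := fun u v huv => f.map_adj_iff.1 (h.le huv)
  refine ⟨SimpleGraph.toSubgraph (K.comap f) hle, isLambdaFactor_of_pathComponent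
    (SimpleGraph.toSubgraph.isSpanning _ _) ?_, fun u v => Iff.rfl⟩
  rintro ⟨v, hv⟩
  obtain ⟨a, b, c, hp, hv'⟩ := h.cover (f v) ((hf _).2 ⟨v, rfl⟩)
  obtain ⟨a, rfl⟩ := (hf a).1 (h.mem _ _ hp.left)
  obtain ⟨b, rfl⟩ := (hf b).1 (h.mem _ _ hp.right)
  obtain ⟨c, rfl⟩ := (hf c).1 (h.mem _ _ hp.right.symm)
  refine ⟨⟨a, trivial⟩, ⟨b, trivial⟩, ⟨c, trivial⟩, ⟨?_, hp.left, hp.right, ?_, ?_, ?_⟩, ?_⟩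
  · exact fun h' => hp.ne (congrArg (fun w => f w.1) h')
  · exact fun w hw => Subtype.ext (f.injective (hp.left_exit _ hw))
  · exact fun w hw => (hp.mid_exit _ hw).imp (fun h' => Subtype.ext (f.injective h'))
      fun h' => Subtype.ext (f.injective h')
  · exact fun w hw => Subtype.ext (f.injective (hp.right_exit _ hw))
  · exact hv'.imp (fun h' => Subtype.ext (f.injective h'))
      (Or.imp (fun h' => Subtype.ext (f.injective h')) fun h' => Subtype.ext (f.injective h'))

/-- The path `x y z` as a subgraph. -/
def threePath {x y z : V} (hxy : G.Adj x y) (hyz : G.Adj y z) : G.Subgraph where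
  verts := {x, y, z}
  Adj u v := (u = x ∧ v = y) ∨ (u = y ∧ v = x) ∨ (u = y ∧ v = z) ∨ (u = z ∧ v = y)
  adj_sub := by
    rintro u v (⟨rfl, rfl⟩ | ⟨rfl, rfl⟩ | ⟨rfl, rfl⟩ | ⟨rfl, rfl⟩)
    exacts [hxy, hxy.symm, hyz, hyz.symm]
  edge_vert := by
    rintro u v (⟨rfl, rfl⟩ | ⟨rfl, rfl⟩ | ⟨rfl, rfl⟩ | ⟨rfl, rfl⟩) <;> simp
  symm := ⟨by
    rintro u v h
    tauto⟩

theorem isThreePathCenteredAt_threePath {x y z : V} (hxy : G.Adj x y) (hyz : G.Adj y z)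
    (hxz : x ≠ z) : IsThreePathCenteredAt (threePath hxy hyz) y := by
  have hx : x ∈ (threePath hxy hyz).verts := Or.inl rfl
  have hy : y ∈ (threePath hxy hyz).verts := Or.inr (Or.inl rfl)
  have hz : z ∈ (threePath hxy hyz).verts := Or.inr (Or.inr rfl)
  let φ : Fin 3 → (threePath hxy hyz).verts := ![⟨x, hx⟩, ⟨y, hy⟩, ⟨z, hz⟩]
  have h1 := hxy.ne
  have h2 := hyz.ne
  have hφ : Function.Bijective φ := by
    constructor
    · intro i j hij
      fin_cases i <;> fin_cases j <;> simp_all [φ]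
    · rintro ⟨w, rfl | rfl | rfl⟩
      exacts [⟨0, rfl⟩, ⟨1, rfl⟩, ⟨2, rfl⟩]
  have hadj : ∀ i j, (threePath hxy hyz).coe.Adj (φ i) (φ j) ↔
      (SimpleGraph.pathGraph 3).Adj i j := by
    intro i j
    rw [SimpleGraph.pathGraph_adj]
    fin_cases i <;> fin_cases j <;>
      simp [φ, threePath, h1, h2, h1.symm, h2.symm, hxz, hxz.symm]
  exact ⟨⟨Equiv.ofBijective φ hφ, fun {i j} => hadj i j⟩, rfl⟩

end

end LambdaPacking

/-! ### The theorem -/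

theorem mainTheorem2 {V : Type*} [Fintype V] (G : SimpleGraph V)
    (hconn : LambdaPacking.IsKConnected G 3)
    (hclaw : LambdaPacking.IsClawFree G)
    (hcard : Fintype.card V ≡ 0 [MOD 3]) :
    (∀ x y : V, G.Adj x y →
      ∃ L₁ L₂ : G.Subgraph, L₁ ≠ L₂ ∧
        ∀ L : G.Subgraph, (L = L₁ ∨ L = L₂) →
          LambdaPacking.IsThreePathCenteredAt L y ∧ L.Adj x y ∧
          (LambdaPacking.minus G L).Connected ∧
          ∃ F : (LambdaPacking.minus G L).Subgraph, LambdaPacking.IsLambdaFactor F) ∧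
    (∀ e ∈ G.edgeSet,
      ∃ F : G.Subgraph, LambdaPacking.IsLambdaFactor F ∧ e ∈ F.edgeSet) := by
  classical
  have hG := hclaw.clawFree
  have h3 := hconn.conn3
  have hc3 : 3 < (Finset.univ : Finset V).card := hconn.1
  have hdvd : 3 ∣ (Finset.univ : Finset V).card := (Nat.modEq_zero_iff_dvd.1 hcard)
  have key : ∀ x y : V, G.Adj x y → ∃ z₁ z₂, z₁ ≠ z₂ ∧ ∀ z, z = z₁ ∨ z = z₂ →
      x ≠ z ∧ G.Adj y z ∧ LambdaPacking.Conn G (Finset.univ \ {x, y, z}) ∧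
        (Finset.univ \ {x, y, z} : Finset V).Nonempty ∧
        LambdaPacking.Fac G (Finset.univ \ {x, y, z}) := by
    intro x y hxy
    obtain ⟨z₁, z₂, hne, hz⟩ :=
      h3.exists_two_chain hG hc3 (Finset.mem_univ x) (Finset.mem_univ y)
    refine ⟨z₁, z₂, hne, fun z hz' => ?_⟩
    obtain ⟨hzS, hyz, hch⟩ := hz z hz'
    have hzx : z ≠ x := by
      rintro rfl
      simp at hzS
    have hset : ((Finset.univ : Finset V) \ {x, y}).erase z = Finset.univ \ {x, y, z} := by
      ext v
      simp only [Finset.mem_erase, Finset.mem_sdiff, Finset.mem_univ, Finset.mem_insert,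
        Finset.mem_singleton]
      tauto
    rw [hset] at hch
    have e := Finset.card_sdiff_add_card_eq_card (Finset.subset_univ ({x, y, z} : Finset V))
    have e3 : ({x, y, z} : Finset V).card = 3 :=
      Finset.card_eq_three.2 ⟨x, y, z, hxy.ne, hzx.symm, hyz.ne, rfl⟩
    exact ⟨hzx.symm, hyz, hch.1, Finset.card_pos.1 (by omega), hch.fac hG (by omega)⟩
  constructor
  · intro x y hxy
    obtain ⟨z₁, z₂, hne, hz⟩ := key x y hxy
    have main : ∀ z (hz : z = z₁ ∨ z = z₂) (hyz : G.Adj y z),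
        LambdaPacking.IsThreePathCenteredAt (LambdaPacking.threePath hxy hyz) y ∧
        (LambdaPacking.threePath hxy hyz).Adj x y ∧
        (LambdaPacking.minus G (LambdaPacking.threePath hxy hyz)).Connected ∧
        ∃ F : (LambdaPacking.minus G (LambdaPacking.threePath hxy hyz)).Subgraph,
          LambdaPacking.IsLambdaFactor F := by
      intro z hz' hyz
      obtain ⟨hxz, -, hconn, hne, hfac⟩ := hz z hz'
      have hmem : ∀ v, v ∈ (LambdaPacking.threePath hxy hyz).vertsᶜ ↔
          v ∈ (Finset.univ \ {x, y, z} : Finset V) := by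
        intro v
        simp [LambdaPacking.threePath]
      obtain ⟨K, hK⟩ := hfac.exists_packs
      obtain ⟨F, hF, -⟩ := hK.exists_isLambdaFactor
        (SimpleGraph.Embedding.induce (LambdaPacking.threePath hxy hyz).vertsᶜ) (by
          intro v
          rw [← hmem]
          exact ⟨fun h => ⟨⟨v, h⟩, rfl⟩, by rintro ⟨w, rfl⟩; exact w.2⟩)
      exact ⟨LambdaPacking.isThreePathCenteredAt_threePath hxy hyz hxz, Or.inl ⟨rfl, rfl⟩,
        hconn.induce_connected hne hmem, F, hF⟩
    have h1 := (hz z₁ (Or.inl rfl))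
    have h2 := (hz z₂ (Or.inr rfl))
    refine ⟨LambdaPacking.threePath hxy h1.2.1, LambdaPacking.threePath hxy h2.2.1, ?_, ?_⟩
    · intro h
      have : z₁ ∈ (LambdaPacking.threePath hxy h2.2.1).verts := by
        rw [← h]
        exact Or.inr (Or.inr rfl)
      rcases this with h' | h' | h'
      exacts [h1.1 h'.symm, h1.2.1.ne h'.symm, hne h']
    · rintro L (rfl | rfl)
      · exact main z₁ (Or.inl rfl) _
      · exact main z₂ (Or.inr rfl) _
  · intro e
    induction e using Sym2.ind with
    | _ x y =>
      intro he
      have hxy : G.Adj x y := he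
      obtain ⟨z, z', -, hz⟩ := key x y hxy
      obtain ⟨hxz, hyz, -, -, hfac⟩ := hz z (Or.inl rfl)
      obtain ⟨K, hK⟩ := hfac.exists_packs
      obtain ⟨K', hK', hadj⟩ := hK.insert_path (a := x) (b := y) (c := z) (by simp) (by simp)
        (by simp) hxz hxy hyz
      obtain ⟨F, hF, hFK⟩ := hK'.exists_isLambdaFactor SimpleGraph.Embedding.refl (by
        intro v
        simp only [Finset.mem_insert, Finset.mem_sdiff, Finset.mem_univ, Finset.mem_singleton]
        refine ⟨fun _ => ⟨v, rfl⟩, fun _ => by tauto⟩)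
      exact ⟨F, hF, (hFK x y).2 hadj⟩
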